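/- **Corollary 6.4 (Comparison of eigenvalues).** For an open set $\Omega\subset\mathbb{R}^2$, let $r_\Omega=\sup\{\rho>0:\ B_\rho(x)\subset\Omega \text{ for some } x\in\Omega\}$ be its inradius, let $W^{1,2}_0(\Omega)$ be the closure of $C_0^\infty(\Omega)$ in $W^{1,2}(\Omega)$, and let $$\lambda_1(\Omega)=\inf_{u\in W^{1,2}_0(\Omega)\setminus\{0\}}\frac{\int_\Omega|\nabla u|^2\,dx}{\int_\Omega |u|^2\,dx}.$$ For $0<s<1$ let $$[u]^2_{W^{s,2}(\mathbb{R}^2)}=\iint_{\mathbb{R}^2\times\mathbb{R}^2}\frac{|u(x)-u(y)|^2}{|x-y|^{2+2s}}\,dx\,dy,$$ let $W^{s,2}(\mathbb{R}^2)=\{u\in L^2(\mathbb{R}^2):[u]_{W^{s,2}(\mathbb{R}^2)}<+\infty\}$ with the norm $\|u\|_{L^2(\mathbb{R}^2)}+[u]_{W^{s,2}(\mathbb{R}^2)}$, let $\widetilde W^{s,2}_0(\Omega)$ be the closure of $C_0^\infty(\Omega)$ in $W^{s,2}(\mathbb{R}^2)$, and let $$\lambda_1^s(\Omega)=\inf_{u\in\widetilde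 W^{s,2}_0(\Omega)\setminus\{0\}}\frac{[u]^2_{W^{s,2}(\mathbb{R}^2)}}{\|u\|^2_{L^2(\Omega)}}.$$ There exist positive constants $\alpha_s,\beta_s$, $1/2<s<1$, depending on $s$ only, such that for every $1/2<s<1$ and every open simply connected (in particular nonempty and connected) set $\Omega\subset\mathbb{R}^2$ with $r_\Omega<+\infty$ we have $$\alpha_s\,\big(\lambda_1(\Omega)\big)^s\le\lambda_1^s(\Omega)\le\beta_s\,\big(\lambda_1(\Omega)\big)^s,$$ and such that each of the three limits $$\lim_{s\searrow 1/2}\frac{\alpha_s}{s-\frac12},\qquad \lim_{s\nearrow1}(1-s)\,\alpha_s,\qquad \lim_{s\nearrow 1}(1-s)\,\beta_s$$ exists and is a positive finite number. -/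

import Mathlib

open MeasureTheory Filter Topology TopologicalSpace
open scoped ENNReal Distributions

noncomputable section

namespace FracEig

/-- The Euclidean space `ℝ^N`. -/
abbrev Eucl (N : ℕ) : Type := EuclideanSpace ℝ (Fin N)

variable {N : ℕ}

/-- The inradius `sup {ρ > 0 : ∃ x ∈ Ω, B_ρ(x) ⊆ Ω}`, as an extended nonnegative number. -/
def inradius (Ω : Opens (Eucl N)) : ℝ≥0∞ :=
  sSup {r | ∃ ρ : ℝ, 0 < ρ ∧ (∃ x ∈ Ω, Metric.ball x ρ ⊆ (Ω : Set (Eucl N))) ∧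
    r = ENNReal.ofReal ρ}

/-- `g` is the weak (distributional) gradient of `u` in `Ω`. -/
def HasWeakGradient (Ω : Opens (Eucl N)) (u : Eucl N → ℝ) (g : Eucl N → Eucl N) : Prop :=
  ∀ (φ : 𝓓(Ω, ℝ)) (v : Eucl N),
    ∫ x in (Ω : Set (Eucl N)), u x * fderiv ℝ φ x v =
      -∫ x in (Ω : Set (Eucl N)), inner ℝ (g x) v * φ x

/-- `u ∈ W^{1,2}(Ω)`, with weak gradient `g`. -/
structure MemW12 (Ω : Opens (Eucl N)) (u : Eucl N → ℝ) (g : Eucl N → Eucl N) : Prop where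
  memLp : MemLp u 2 (volume.restrict Ω)
  memLp_grad : MemLp g 2 (volume.restrict Ω)
  weakGrad : HasWeakGradient Ω u g

/-- `u ∈ W^{1,2}_0(Ω)`, with weak gradient `g`: the closure of the smooth functions compactly
supported in `Ω`, with respect to the norm of `W^{1,2}(Ω)`. -/
structure MemW120 (Ω : Opens (Eucl N)) (u : Eucl N → ℝ) (g : Eucl N → Eucl N) : Prop
    extends MemW12 Ω u g where
  approx : ∀ ε : ℝ≥0∞, 0 < ε → ∃ φ : 𝓓(Ω, ℝ),
    eLpNorm (fun x => u x - φ x) 2 (volume.restrict Ω) +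
      eLpNorm (fun x => g x - gradient φ x) 2 (volume.restrict Ω) < ε

/-- `λ₁(Ω)`, the infimum over `u ∈ W^{1,2}_0(Ω) ∖ {0}` of `∫_Ω |∇u|² / ∫_Ω |u|²`. -/
def lambdaOne (Ω : Opens (Eucl N)) : ℝ≥0∞ :=
  ⨅ (u : Eucl N → ℝ) (g : Eucl N → Eucl N) (_ : MemW120 Ω u g)
    (_ : ¬ u =ᵐ[volume.restrict Ω] 0),
    (∫⁻ x in (Ω : Set (Eucl N)), ‖g x‖ₑ ^ 2) / ∫⁻ x in (Ω : Set (Eucl N)), ‖u x‖ₑ ^ 2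

/-- The squared Gagliardo-Slobodeckij seminorm
`∬ |u(x) - u(y)|² / |x - y|^{N + 2s} dx dy` on `ℝ^N × ℝ^N`. -/
def gagliardoSq (s : ℝ) (u : Eucl N → ℝ) : ℝ≥0∞ :=
  ∫⁻ x, ∫⁻ y, ‖u x - u y‖ₑ ^ 2 / ‖x - y‖ₑ ^ ((N : ℝ) + 2 * s)

/-- The Gagliardo-Slobodeckij seminorm on `ℝ^N`. -/
def gagliardo (s : ℝ) (u : Eucl N → ℝ) : ℝ≥0∞ := gagliardoSq s u ^ (1 / 2 : ℝ)

/-- `u ∈ W^{s,2}(ℝ^N)`. -/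
structure MemWs2 (s : ℝ) (u : Eucl N → ℝ) : Prop where
  memLp : MemLp u 2 volume
  gagliardo_lt_top : gagliardo s u < ∞

/-- The closure in `W^{s,2}(ℝ^N)` of the smooth functions compactly supported in `Ω`. -/
structure MemWs20 (s : ℝ) (Ω : Opens (Eucl N)) (u : Eucl N → ℝ) : Prop
    extends MemWs2 s u where
  approx : ∀ ε : ℝ≥0∞, 0 < ε → ∃ φ : 𝓓(Ω, ℝ),
    eLpNorm (fun x => u x - φ x) 2 volume + gagliardo s (fun x => u x - φ x) < ε

/-- `λ₁ˢ(Ω)`, the infimum of `[u]²_{W^{s,2}(ℝ^N)} / ‖u‖²_{L²(Ω)}` over the nonzero `u` in the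
closure in `W^{s,2}(ℝ^N)` of the smooth functions compactly supported in `Ω`. -/
def lambdaFrac (s : ℝ) (Ω : Opens (Eucl N)) : ℝ≥0∞ :=
  ⨅ (u : Eucl N → ℝ) (_ : MemWs20 s Ω u) (_ : ¬ u =ᵐ[volume] 0),
    gagliardo s u ^ 2 / ∫⁻ x in (Ω : Set (Eucl N)), ‖u x‖ₑ ^ 2

end FracEig

end

/-!
The upper bound is an interpolation inequality valid in every open set. Writing the seminorm as
`∫ D(h) / |h|^{2+2s} dh`, where `D(h)` is the squared `L²` norm of `u(· + h) - u`, and splitting at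
`|h| = ‖u‖ / ‖∇u‖` with `D(h) ≤ min (|h|² ‖∇u‖²) (4 ‖u‖²)`, one gets
`[u]² ≤ C / (1 - s) ‖u‖^{2(1-s)} ‖∇u‖^{2s}` for test functions (`gagliardoSq_le_interpolation`).

For the lower bound both eigenvalues are compared with the inradius `r`. Testing with a bump
function in a ball gives `λ₁ ≤ C / r²` (`exists_lambdaOne_le`), so a fractional Poincaré inequality
`‖u‖² ≤ C (1 - s) / (s - 1/2) r^{2s} [u]²` is needed. Simple connectedness enters only through
`exists_notMem_dist_eq`: a circle centred outside `Ω` is not contained in `Ω`, since no continuous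
logarithm exists along it. Hence `u` vanishes somewhere on every circle around every point of the
complement, and the complement meets every ball of radius larger than `r`.

At a zero `z` of `u`, root mean squares over annuli shrinking to `z` telescope, and
`eLpNorm_annulus_sq_le` bounds the outermost one by a double integral with exponent `3 + 2s` over
pairs satisfying `|x - z| ≤ 4 |x - y|`. When `z` lies on the circle of radius `ρ` around `p`, this
condition implies `||x - p| - ρ| ≤ 4 |x - y|`; averaging over `ρ` then gains the missing power of
`|x - y|` (`exists_radius_lintegral_le`). Averaging the resulting local inequality over the plane
gives a global one with constant `C / (2s - 1)` and differences of bounded length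
(`lintegral_sq_le_of_circles`). The factor `1 - s` comes from `D(2h) ≤ 4 D(h)`, which forces each
dyadic shell in `h` to carry at most a fraction `O(1 - s)` of the seminorm; for `s ≥ 3/4` the
inequality of order `5/8` therefore implies the one of order `s` with the right constant
(`lintegral_ball_five_eighths_le`).

With these bounds, `α` and `β` can be taken as explicit multiples of `(2s - 1) / (1 - s)` and
`1 / (1 - s)`.
-/

namespace FracEig

/-! ### Circles centred outside a simply connected set -/

/-- A circle centred outside a simply connected open set is not contained in that set: otherwise
a continuous logarithm of `x - p` would exist along the circle. -/
theorem exists_notMem_dist_eq {Ω : Set (Eucl 2)} (hΩ : IsSimplyConnected Ω) (hO : IsOpen Ω)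
    {p : Eucl 2} (hp : p ∉ Ω) {ρ : ℝ} (hρ : 0 < ρ) : ∃ z, z ∉ Ω ∧ dist z p = ρ := by
  by_contra! hcon
  let g : Eucl 2 → ℂ := fun x => Complex.orthonormalBasisOneI.repr.symm (x - p)
  have hg : Continuous g := by fun_prop
  have hg0 : (0 : ℂ) ∉ g '' Ω := by
    rintro ⟨x, hx, h⟩
    have : x - p = 0 := (LinearIsometryEquiv.map_eq_zero_iff _).1 h
    exact hp (by rwa [← sub_eq_zero.1 this])
  obtain ⟨L, hLc, hL⟩ :=
    Complex.exists_continuousOn_eqOn_exp_comp hΩ hO hg.continuousOn hg0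
  let c : ℝ → Eucl 2 := fun θ =>
    p + Complex.orthonormalBasisOneI.repr (ρ * Complex.exp (θ * Complex.I))
  have hc : Continuous c := by fun_prop
  have hcd : ∀ θ, dist (c θ) p = ρ := fun θ => by
    simp [c, Complex.norm_exp_ofReal_mul_I, abs_of_pos hρ]
  have hcΩ : ∀ θ, c θ ∈ Ω := fun θ => by
    by_contra h
    exact hcon _ h (hcd θ)
  have hgc : ∀ θ, g (c θ) = ρ * Complex.exp (θ * Complex.I) := fun θ => by
    simp only [g, c, add_sub_cancel_left, LinearIsometryEquiv.symm_apply_apply]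
  -- `L ∘ c` minus `iθ` is continuous with values in `log ρ + 2πiℤ`, hence constant.
  let M : ℝ → ℂ := fun θ => L (c θ) - θ * Complex.I
  have hM : Continuous M := by
    have h1 : Continuous fun θ => L (c θ) := hLc.comp_continuous hc hcΩ
    exact h1.sub (by fun_prop)
  -- `exp ∘ M` is constant, although `M` drops by `2πi` along the full circle.
  have hexp : ∀ θ, Complex.exp (M θ) = ρ := fun θ => by
    have h := hL (hcΩ θ)
    simp only [Function.comp] at h
    simp only [M, Complex.exp_sub, h, hgc]
    field_simp
  have hper : M (2 * Real.pi) = M 0 - 2 * Real.pi * Complex.I := by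
    have : c (2 * Real.pi) = c 0 := by simp [c, Complex.exp_two_pi_mul_I]
    simp [M, this]
  have hconst : M (2 * Real.pi) = M 0 := by
    refine (isPreconnected_univ (α := ℝ)).constant_of_mapsTo (T := {w : ℂ | Complex.exp w = ρ})
      ?_ hM.continuousOn (fun θ _ => hexp θ) trivial trivial
    -- The fibres of the covering map `exp` are discrete.
    have hne : (ρ : ℂ) ∈ ({0}ᶜ : Set ℂ) := by simpa using hρ.ne'
    have : DiscreteTopology (Complex.exp ⁻¹' {(ρ : ℂ)}) := (Complex.isCoveringMapOn_exp _ hne).1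
    exact isDiscrete_iff_discreteTopology.2 this
  rw [hper] at hconst
  have : (2 * Real.pi * Complex.I : ℂ) = 0 := by linear_combination -hconst
  simp [Real.pi_ne_zero] at this

/-! ### Trace estimate at a zero -/

/-- The weighted squared difference `|f x - f y|² / |x - y|ᵗ`, with value `0` on the diagonal
when `t > 0`. -/
noncomputable def incr (t : ℝ) (f : Eucl 2 → ℝ) (x y : Eucl 2) : ℝ≥0∞ :=
  ‖f x - f y‖ₑ ^ 2 / ‖x - y‖ₑ ^ t

theorem measurable_incr (t : ℝ) {f : Eucl 2 → ℝ} (hf : Measurable f) :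
    Measurable fun p : Eucl 2 × Eucl 2 => incr t f p.1 p.2 := by
  unfold incr
  have h1 : Measurable fun p : Eucl 2 × Eucl 2 => f p.1 := hf.comp measurable_fst
  have h2 : Measurable fun p : Eucl 2 × Eucl 2 => f p.2 := hf.comp measurable_snd
  fun_prop

theorem enorm_sub_sq_le_incr {t d : ℝ} (ht : 0 ≤ t) (f : Eucl 2 → ℝ) {x y : Eucl 2}
    (hd : dist x y ≤ d) : ‖f x - f y‖ₑ ^ 2 ≤ ENNReal.ofReal (d ^ t) * incr t f x y := by
  rcases eq_or_ne x y with rfl | hxy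
  · simp
  have h0 : ‖x - y‖ₑ ≠ 0 := by simpa [sub_eq_zero] using hxy
  have hle : ‖x - y‖ₑ ^ t ≤ ENNReal.ofReal (d ^ t) := by
    rw [← ENNReal.ofReal_rpow_of_nonneg (dist_nonneg.trans hd) ht]
    refine ENNReal.rpow_le_rpow ?_ ht
    rw [← edist_eq_enorm_sub, edist_dist]
    exact ENNReal.ofReal_le_ofReal hd
  have h1 : ‖x - y‖ₑ ^ t ≠ 0 := by simp [ENNReal.rpow_eq_zero_iff, h0]
  have h2 : ‖x - y‖ₑ ^ t ≠ ∞ := ENNReal.rpow_ne_top_of_nonneg ht enorm_ne_top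
  calc ‖f x - f y‖ₑ ^ 2 = ‖x - y‖ₑ ^ t * incr t f x y := (ENNReal.mul_div_cancel h1 h2).symm
    _ ≤ _ := by gcongr

/-- Multiplying by `|x - y|` lowers the exponent by one, also on the diagonal, where both sides
vanish. -/
theorem incr_add_one {t : ℝ} (f : Eucl 2 → ℝ) (x y : Eucl 2) :
    ‖x - y‖ₑ * incr (t + 1) f x y = incr t f x y := by
  rcases eq_or_ne x y with rfl | hxy
  · simp [incr]
  have h0 : ‖x - y‖ₑ ≠ 0 := by simpa [sub_eq_zero] using hxy
  rw [incr, ENNReal.rpow_add _ _ h0 enorm_ne_top, ENNReal.rpow_one, incr, ← mul_div_assoc,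
    mul_comm (‖x - y‖ₑ), ENNReal.mul_div_mul_right _ _ h0 enorm_ne_top]

theorem eLpNorm_two_sq {α : Type*} [MeasurableSpace α] {F : Type*} [NormedAddCommGroup F]
    (g : α → F) (μ : Measure α) : eLpNorm g 2 μ ^ 2 = ∫⁻ x, ‖g x‖ₑ ^ 2 ∂μ := by
  have := eLpNorm_nnreal_pow_eq_lintegral (f := g) (μ := μ) (p := 2) two_ne_zero
  simpa using this

open ProbabilityTheory in
theorem prod_cond (A B : Set (Eucl 2)) :
    (cond volume A).prod (cond volume B) =
      ((volume A)⁻¹ * (volume B)⁻¹) •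
        (volume : Measure (Eucl 2 × Eucl 2)).restrict (A ×ˢ B) := by
  rw [ProbabilityTheory.cond, ProbabilityTheory.cond, Measure.prod_smul_left,
    Measure.prod_smul_right, smul_smul, Measure.prod_restrict, Measure.volume_eq_prod]

open ProbabilityTheory in
/-- Comparison of the root mean squares of a function over two sets; the error `e` is the `L²` norm
of `f x - f y` for independent uniform points `x ∈ A`, `y ∈ B`. -/
theorem eLpNorm_cond_le {f : Eucl 2 → ℝ} (hf : Continuous f) {A B : Set (Eucl 2)}
    (hA0 : volume A ≠ 0) (hA1 : volume A ≠ ∞)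
    (hB0 : volume B ≠ 0) (hB1 : volume B ≠ ∞) {t d : ℝ} (ht : 0 ≤ t)
    (hd : ∀ x ∈ A, ∀ y ∈ B, dist x y ≤ d) :
    ∃ e : ℝ≥0∞, eLpNorm f 2 (cond volume A) ≤ eLpNorm f 2 (cond volume B) + e ∧
      e ^ 2 ≤ (volume A)⁻¹ * (volume B)⁻¹ * ENNReal.ofReal (d ^ t) *
        ∫⁻ p in A ×ˢ B, incr t f p.1 p.2 := by
  have : IsProbabilityMeasure (cond volume A) := cond_isProbabilityMeasure_of_finite hA0 hA1
  have : IsProbabilityMeasure (cond volume B) := cond_isProbabilityMeasure_of_finite hB0 hB1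
  let μ := (cond volume A).prod (cond volume B)
  refine ⟨eLpNorm (fun p => f p.1 - f p.2) 2 μ, ?_, ?_⟩
  · have h1 : eLpNorm (fun p => f p.1) 2 μ = eLpNorm f 2 (cond volume A) :=
      eLpNorm_comp_measurePreserving hf.aestronglyMeasurable measurePreserving_fst
    have h2 : eLpNorm (fun p => f p.2) 2 μ = eLpNorm f 2 (cond volume B) :=
      eLpNorm_comp_measurePreserving hf.aestronglyMeasurable measurePreserving_snd
    rw [← h1, ← h2]
    have h3 : (fun p : Eucl 2 × Eucl 2 => f p.1) =
        (fun p => f p.2) + fun p => f p.1 - f p.2 := by ext p; simp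
    rw [h3]
    exact eLpNorm_add_le (by fun_prop) (by fun_prop) (by norm_num)
  · rw [eLpNorm_two_sq, show μ = _ from prod_cond A B, lintegral_smul_measure,
      smul_eq_mul, mul_assoc, mul_assoc, mul_assoc,
      ← lintegral_const_mul _ (measurable_incr t hf.measurable)]
    refine mul_le_mul_right (mul_le_mul_right ?_ _) _
    refine setLIntegral_mono ((measurable_incr t hf.measurable).const_mul _) fun p hp => ?_
    exact enorm_sub_sq_le_incr ht f (hd _ hp.1 _ hp.2)

theorem add_sq_le_two_mul (a b : ℝ≥0∞) : (a + b) ^ 2 ≤ 2 * (a ^ 2 + b ^ 2) := by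
  have := ENNReal.rpow_add_le_mul_rpow_add_rpow a b (p := 2) (by norm_num)
  norm_num at this
  exact this

theorem rpow_half_sq (a : ℝ≥0∞) : (a ^ (1 / 2 : ℝ)) ^ 2 = a := by
  rw [← ENNReal.rpow_natCast, ← ENNReal.rpow_mul]
  norm_num

theorem sq_rpow_half (a : ℝ≥0∞) : (a ^ 2) ^ (1 / 2 : ℝ) = a := by
  rw [← ENNReal.rpow_natCast, ← ENNReal.rpow_mul]
  norm_num

/-- The Cauchy-Schwarz inequality for finite sums of extended nonnegative reals. -/
theorem sq_sum_le_sum_mul_sum {n : ℕ} {e c w : ℕ → ℝ≥0∞} (h : ∀ k, e k ^ 2 ≤ c k * w k) :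
    (∑ k ∈ Finset.range n, e k) ^ 2 ≤
      (∑ k ∈ Finset.range n, c k) * ∑ k ∈ Finset.range n, w k := by
  have h1 : ∀ k, e k ≤ c k ^ (1 / 2 : ℝ) * w k ^ (1 / 2 : ℝ) := fun k => by
    rw [← ENNReal.mul_rpow_of_nonneg _ _ (by norm_num), ← sq_rpow_half (e k)]
    exact ENNReal.rpow_le_rpow (h k) (by norm_num)
  have h2 := ENNReal.inner_le_Lp_mul_Lq (Finset.range n) (fun k => c k ^ (1 / 2 : ℝ))
    (fun k => w k ^ (1 / 2 : ℝ)) (p := 2) (q := 2) (by constructor <;> norm_num)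
  simp only [ENNReal.rpow_two, rpow_half_sq] at h2
  calc _ ≤ ((∑ k ∈ Finset.range n, c k) ^ (1 / 2 : ℝ) *
        (∑ k ∈ Finset.range n, w k) ^ (1 / 2 : ℝ)) ^ 2 := by
        gcongr
        exact (Finset.sum_le_sum fun k _ => h1 k).trans h2
    _ = _ := by
        rw [mul_pow, rpow_half_sq, rpow_half_sq]

/-- The annulus `{x : r / 2 ≤ |x - z| < r}`. -/
def annulus (z : Eucl 2) (r : ℝ) : Set (Eucl 2) := Metric.ball z r \ Metric.ball z (r / 2)

theorem measurableSet_annulus (z : Eucl 2) (r : ℝ) : MeasurableSet (annulus z r) :=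
  measurableSet_ball.diff measurableSet_ball

theorem disjoint_annulus (z : Eucl 2) {r r' : ℝ} (h : r' ≤ r / 2) :
    Disjoint (annulus z r) (annulus z r') :=
  Set.disjoint_left.2 fun _ hx hx' => hx.2 (Metric.ball_subset_ball h hx'.1)

theorem volume_annulus (z : Eucl 2) {r : ℝ} (hr : 0 ≤ r) :
    volume (annulus z r) = ENNReal.ofReal (3 / 4 * Real.pi * r ^ 2) := by
  rw [annulus, measure_sdiff (Metric.ball_subset_ball (by linarith))
    measurableSet_ball.nullMeasurableSet measure_ball_lt_top.ne,
    EuclideanSpace.volume_ball_fin_two, EuclideanSpace.volume_ball_fin_two,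
    ← ENNReal.ofReal_pow hr, ← ENNReal.ofReal_pow (by positivity),
    ← ENNReal.ofReal_mul (by positivity), ← ENNReal.ofReal_mul (by positivity),
    ← ENNReal.ofReal_sub _ (by positivity)]
  congr 1
  ring

theorem volume_annulus_ne_zero (z : Eucl 2) {r : ℝ} (hr : 0 < r) : volume (annulus z r) ≠ 0 := by
  rw [volume_annulus z hr.le]
  simp only [ne_eq, ENNReal.ofReal_eq_zero, not_le]
  positivity

theorem volume_annulus_ne_top (z : Eucl 2) {r : ℝ} (hr : 0 < r) : volume (annulus z r) ≠ ∞ := by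
  rw [volume_annulus z hr.le]
  exact ENNReal.ofReal_ne_top

open ProbabilityTheory in
/-- The root mean square over annuli shrinking to a zero of `f` tends to `0`. -/
theorem tendsto_eLpNorm_annulus {f : Eucl 2 → ℝ} (hf : Continuous f) {z : Eucl 2} (hz : f z = 0) :
    Tendsto (fun k : ℕ => eLpNorm f 2 (cond volume (annulus z ((1 / 4 : ℝ) ^ k)))) atTop (𝓝 0) := by
  rw [ENNReal.tendsto_nhds_zero]
  intro ε hε
  rcases eq_or_ne ε ∞ with rfl | hε'
  · exact Eventually.of_forall fun _ => le_top
  obtain ⟨δ, hδ, hδf⟩ := Metric.continuousAt_iff.1 (hf.continuousAt (x := z)) ε.toReal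
    (ENNReal.toReal_pos hε.ne' hε')
  have hpow : Tendsto (fun k : ℕ => (1 / 4 : ℝ) ^ k) atTop (𝓝 0) :=
    tendsto_pow_atTop_nhds_zero_of_lt_one (by norm_num) (by norm_num)
  filter_upwards [hpow.eventually (gt_mem_nhds hδ)] with k hk
  have hk0 : 0 < (1 / 4 : ℝ) ^ k := by positivity
  have : IsProbabilityMeasure (cond volume (annulus z ((1 / 4 : ℝ) ^ k))) :=
    cond_isProbabilityMeasure_of_finite (volume_annulus_ne_zero z hk0)
      (volume_annulus_ne_top z hk0)
  have hb : ∀ᵐ x ∂(cond volume (annulus z ((1 / 4 : ℝ) ^ k))), ‖f x‖ ≤ ε.toReal := by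
    refine (ae_cond_mem (measurableSet_annulus z _)).mono fun x hx => ?_
    have := hδf ((Metric.mem_ball.1 hx.1).trans hk)
    rw [hz, dist_zero_right] at this
    exact this.le
  refine (eLpNorm_le_of_ae_bound hb).trans ?_
  rw [measure_univ, ENNReal.one_rpow, one_mul, ENNReal.ofReal_toReal hε']

/-- The factor in front of the double integral when the annuli of radii `4⁻ᵏ` and `4⁻ᵏ⁻¹`, whose
points have distance at most `5/4 · 4⁻ᵏ`, are compared with the exponent `3 + 2s`. -/
theorem annulus_coeff_le {s : ℝ} (h1 : 1 / 2 < s) (h2 : s < 1) (k : ℕ) :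
    (3 / 4 * Real.pi * ((1 / 4 : ℝ) ^ k) ^ 2)⁻¹ *
      (3 / 4 * Real.pi * ((1 / 4 : ℝ) ^ (k + 1)) ^ 2)⁻¹ *
      (5 / 4 * (1 / 4 : ℝ) ^ k) ^ (3 + 2 * s) ≤ 16 * ((1 / 4 : ℝ) ^ (2 * s - 1)) ^ k := by
  have hk : 0 < (1 / 4 : ℝ) ^ k := by positivity
  have hpow : ((1 / 4 : ℝ) ^ k) ^ (3 + 2 * s) =
      ((1 / 4 : ℝ) ^ k) ^ 4 * ((1 / 4 : ℝ) ^ (2 * s - 1)) ^ k := by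
    rw [show 3 + 2 * s = ((4 : ℕ) : ℝ) + (2 * s - 1) by push_cast; ring, Real.rpow_add hk,
      Real.rpow_natCast, ← Real.rpow_natCast (1 / 4) k, ← Real.rpow_mul (by norm_num),
      mul_comm (k : ℝ), Real.rpow_mul (by norm_num) (2 * s - 1),
      Real.rpow_natCast, Real.rpow_natCast]
  have hd : (5 / 4 : ℝ) ^ (3 + 2 * s) ≤ 4 := by
    calc (5 / 4 : ℝ) ^ (3 + 2 * s) ≤ (5 / 4 : ℝ) ^ (5 : ℝ) :=
          Real.rpow_le_rpow_of_exponent_le (by norm_num) (by linarith)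
      _ ≤ 4 := by norm_num
  have hpi : 9 ≤ Real.pi ^ 2 := by nlinarith [Real.pi_gt_three]
  rw [Real.mul_rpow (by norm_num) hk.le, hpow, pow_succ (1 / 4 : ℝ) k]
  set q := ((1 / 4 : ℝ) ^ (2 * s - 1)) ^ k with hq
  have hq0 : 0 ≤ q := by positivity
  set r := (1 / 4 : ℝ) ^ k with hr
  have : (3 / 4 * Real.pi * r ^ 2)⁻¹ * (3 / 4 * Real.pi * (r * (1 / 4)) ^ 2)⁻¹ *
      ((5 / 4) ^ (3 + 2 * s) * (r ^ 4 * q)) =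
      (5 / 4) ^ (3 + 2 * s) * (256 / 9) / Real.pi ^ 2 * q := by
    field_simp
    ring
  rw [this]
  gcongr
  rw [div_le_iff₀ (by positivity)]
  nlinarith

/-- The geometric series responsible for the blow-up as `s → 1/2`; its ratio is at most
`1 - 3/4 (2s - 1)` by Bernoulli's inequality. -/
theorem sum_geom_le {s : ℝ} (h1 : 1 / 2 < s) (h2 : s < 1) (n : ℕ) :
    ∑ k ∈ Finset.range n, ((1 / 4 : ℝ) ^ (2 * s - 1)) ^ k ≤ 4 / 3 * (1 / (2 * s - 1)) := by
  have hb : (1 / 4 : ℝ) ^ (2 * s - 1) ≤ 1 - 3 / 4 * (2 * s - 1) := by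
    have := rpow_one_add_le_one_add_mul_self (s := -3 / 4) (p := 2 * s - 1)
      (by norm_num) (by linarith) (by linarith)
    rw [show (1 : ℝ) + -3 / 4 = 1 / 4 by norm_num] at this
    linarith
  set q := (1 / 4 : ℝ) ^ (2 * s - 1) with hq
  have hq0 : 0 ≤ q := by positivity
  have hs : 0 < 2 * s - 1 := by linarith
  have hq1 : 0 < 1 - q := by linarith
  calc ∑ k ∈ Finset.range n, q ^ k ≤ (1 - q)⁻¹ := by
        rw [← one_div, le_div_iff₀ hq1, mul_comm, mul_neg_geom_sum]
        linarith [pow_nonneg hq0 n]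
    _ ≤ (3 / 4 * (2 * s - 1))⁻¹ := by
        gcongr
        linarith
    _ = _ := by field_simp

open ProbabilityTheory in
/-- Trace estimate at a zero `z` of `f`, by telescoping root mean squares over annuli shrinking to
`z`. Applying Cauchy-Schwarz to the increments, instead of bounding each of them by the full double
integral, keeps the constant linear in `1 / (2s - 1)`. -/
theorem eLpNorm_annulus_sq_le {s : ℝ} (h1 : 1 / 2 < s) (h2 : s < 1) {f : Eucl 2 → ℝ}
    (hf : Continuous f) {z : Eucl 2} (hz : f z = 0) :
    eLpNorm f 2 (cond volume (annulus z 1)) ^ 2 ≤ ENNReal.ofReal (22 / (2 * s - 1)) *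
      ∫⁻ p in {p : Eucl 2 × Eucl 2 | p.1 ∈ Metric.ball z 1 ∧ p.2 ∈ Metric.ball z 1 ∧
        dist p.1 z ≤ 4 * dist p.1 p.2}, incr (3 + 2 * s) f p.1 p.2 := by
  set r : ℕ → ℝ := fun k => (1 / 4 : ℝ) ^ k with hr
  have hr0 : ∀ k, 0 < r k := fun k => by positivity
  have hr1 : ∀ k, r k ≤ 1 := fun k => pow_le_one₀ (by norm_num) (by norm_num)
  have hrs : ∀ k, r (k + 1) = r k / 4 := fun k => by simp only [hr, pow_succ]; ring
  let A : ℕ → Set (Eucl 2) := fun k => annulus z (r k)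
  let w : ℕ → ℝ≥0∞ := fun k => ∫⁻ p in A k ×ˢ A (k + 1), incr (3 + 2 * s) f p.1 p.2
  let a : ℕ → ℝ≥0∞ := fun k => eLpNorm f 2 (cond volume (A k))
  set W := ∫⁻ p in {p : Eucl 2 × Eucl 2 | p.1 ∈ Metric.ball z 1 ∧ p.2 ∈ Metric.ball z 1 ∧
        dist p.1 z ≤ 4 * dist p.1 p.2}, incr (3 + 2 * s) f p.1 p.2 with hW
  have hstep : ∀ k, ∃ e : ℝ≥0∞, a k ≤ a (k + 1) + e ∧
      e ^ 2 ≤ ENNReal.ofReal (16 * ((1 / 4 : ℝ) ^ (2 * s - 1)) ^ k) * w k := by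
    intro k
    obtain ⟨e, he1, he2⟩ := eLpNorm_cond_le hf (A := annulus z (r k))
      (B := annulus z (r (k + 1))) (volume_annulus_ne_zero z (hr0 _))
      (volume_annulus_ne_top z (hr0 _)) (volume_annulus_ne_zero z (hr0 _))
      (volume_annulus_ne_top z (hr0 _)) (t := 3 + 2 * s) (d := 5 / 4 * r k) (by linarith) (by
        intro x hx y hy
        have hx' := Metric.mem_ball.1 hx.1
        have hy' := Metric.mem_ball.1 hy.1
        rw [hrs] at hy'
        linarith [dist_triangle_right x y z])
    refine ⟨e, he1, he2.trans ?_⟩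
    refine mul_le_mul_left ?_ _
    rw [volume_annulus z (hr0 _).le, volume_annulus z (hr0 _).le,
      ← ENNReal.ofReal_inv_of_pos (by have := hr0 k; positivity),
      ← ENNReal.ofReal_inv_of_pos (by have := hr0 (k + 1); positivity),
      ← ENNReal.ofReal_mul (by positivity), ← ENNReal.ofReal_mul (by positivity)]
    exact ENNReal.ofReal_le_ofReal (annulus_coeff_le h1 h2 k)
  choose e he1 he2 using hstep
  -- The products `A k ×ˢ A (k + 1)` are disjoint, and `|x - z| ≤ 4 |x - y|` holds on each of them.
  have hsumw : ∀ n, ∑ k ∈ Finset.range n, w k ≤ W := by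
    intro n
    have hmeas : ∀ k, MeasurableSet (A k ×ˢ A (k + 1)) := fun k =>
      (measurableSet_annulus z _).prod (measurableSet_annulus z _)
    have hdis : Pairwise (Function.onFun Disjoint fun k => A k ×ˢ A (k + 1)) := by
      have key : ∀ i j, i < j → Disjoint (A i) (A j) := by
        intro i j hij
        refine disjoint_annulus z ?_
        have h3 : r j ≤ r (i + 1) := pow_le_pow_of_le_one (by norm_num) (by norm_num) hij
        rw [hrs] at h3
        linarith [hr0 i]
      intro i j hij
      refine Set.disjoint_prod.2 (Or.inl ?_)
      rcases lt_or_gt_of_ne hij with h | h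
      · exact key i j h
      · exact (key j i h).symm
    calc ∑ k ∈ Finset.range n, w k ≤ ∑' k, w k := ENNReal.sum_le_tsum _
      _ = ∫⁻ p in ⋃ k, A k ×ˢ A (k + 1), incr (3 + 2 * s) f p.1 p.2 :=
        (lintegral_iUnion hmeas hdis _).symm
      _ ≤ W := by
        refine lintegral_mono_set (Set.iUnion_subset fun k p hp => ?_)
        have h3 := Metric.mem_ball.1 hp.1.1
        have h4 : r k / 2 ≤ dist p.1 z := not_lt.1 hp.1.2
        have h5 := Metric.mem_ball.1 hp.2.1
        have h6 := hrs k
        have h7 := dist_triangle p.1 p.2 z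
        refine ⟨Metric.mem_ball.2 (h3.trans_le (hr1 k)),
          Metric.mem_ball.2 (h5.trans_le (hr1 _)), ?_⟩
        linarith
  have htel : ∀ n, a 0 ≤ a n + ∑ k ∈ Finset.range n, e k := by
    intro n
    induction n with
    | zero => simp
    | succ n ih =>
      rw [Finset.sum_range_succ, add_comm _ (e n), ← add_assoc]
      exact ih.trans (by gcongr; exact he1 n)
  have hbound : ∀ n, (∑ k ∈ Finset.range n, e k) ^ 2 ≤ ENNReal.ofReal (22 / (2 * s - 1)) * W := by
    intro n
    refine (sq_sum_le_sum_mul_sum he2).trans ?_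
    gcongr
    · rw [← ENNReal.ofReal_sum_of_nonneg (fun k _ => by positivity), ← Finset.mul_sum]
      refine ENNReal.ofReal_le_ofReal ?_
      have := sum_geom_le h1 h2 n
      have h3 : 0 < 1 / (2 * s - 1) := by have : 0 < 2 * s - 1 := by linarith
                                          positivity
      rw [div_eq_mul_one_div 22]
      linarith
    · exact hsumw n
  have hbound' : ∀ n, ∑ k ∈ Finset.range n, e k ≤
      (ENNReal.ofReal (22 / (2 * s - 1)) * W) ^ (1 / 2 : ℝ) := by
    intro n
    rw [← sq_rpow_half (∑ k ∈ Finset.range n, e k)]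
    exact ENNReal.rpow_le_rpow (hbound n) (by norm_num)
  have hlim : Tendsto (fun n => a n + (ENNReal.ofReal (22 / (2 * s - 1)) * W) ^ (1 / 2 : ℝ)) atTop
      (𝓝 (0 + (ENNReal.ofReal (22 / (2 * s - 1)) * W) ^ (1 / 2 : ℝ))) :=
    (tendsto_eLpNorm_annulus hf hz).add tendsto_const_nhds
  have := ge_of_tendsto' hlim fun n => (htel n).trans (by gcongr; exact hbound' n)
  rw [zero_add] at this
  calc _ = a 0 ^ 2 := by simp [a, A, r]
    _ ≤ _ := by
      rw [← rpow_half_sq (ENNReal.ofReal (22 / (2 * s - 1)) * W)]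
      gcongr

/-! ### Poincaré inequality for functions vanishing on many circles -/

/-- Averaging over the radii of circles around `p` gains one power of `|x - y|`, and some radius
does at least as well as the average. The domain on the left contains, up to a bound on the
distances, the domain of the trace estimate at any point of the circle of radius `ρ`, so that no
measurable choice of such points is needed. -/
theorem exists_radius_lintegral_le {f : Eucl 2 → ℝ} (hf : Measurable f) (t : ℝ) (p : Eucl 2)
    (S : Set (Eucl 2 × Eucl 2)) :
    ∃ ρ ∈ Set.Ioo (0 : ℝ) 1,
      ∫⁻ q in S ∩ {q | |dist q.1 p - ρ| ≤ 4 * dist q.1 q.2}, incr (t + 1) f q.1 q.2 ≤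
        8 * ∫⁻ q in S, incr t f q.1 q.2 := by
  let U : Set (ℝ × (Eucl 2 × Eucl 2)) := {w | |dist w.2.1 p - w.1| ≤ 4 * dist w.2.1 w.2.2}
  have hU : MeasurableSet U := (isClosed_le (by fun_prop) (by fun_prop)).measurableSet
  let F : ℝ → Eucl 2 × Eucl 2 → ℝ≥0∞ := fun ρ q =>
    U.indicator (fun w => incr (t + 1) f w.2.1 w.2.2) (ρ, q)
  have hF : Measurable (Function.uncurry F) :=
    ((measurable_incr (t + 1) hf).comp measurable_snd).indicator hU
  have hV : Measurable fun ρ => ∫⁻ q in S, F ρ q := hF.lintegral_prod_right'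
  obtain ⟨ρ, hρ, hle⟩ := exists_le_setLAverage (μ := volume) (s := Set.Ioo (0 : ℝ) 1)
    (by simp) (by simp) hV.aemeasurable
  refine ⟨ρ, hρ, ?_⟩
  have hVρ : ∫⁻ q in S ∩ {q | |dist q.1 p - ρ| ≤ 4 * dist q.1 q.2}, incr (t + 1) f q.1 q.2 =
      ∫⁻ q in S, F ρ q := by
    have hm : MeasurableSet {q : Eucl 2 × Eucl 2 | |dist q.1 p - ρ| ≤ 4 * dist q.1 q.2} :=
      (isClosed_le (by fun_prop) (by fun_prop)).measurableSet
    rw [Set.inter_comm, ← Measure.restrict_restrict hm, ← lintegral_indicator hm]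
    rfl
  rw [hVρ]
  refine hle.trans ?_
  rw [setLAverage_eq]
  simp only [Real.volume_Ioo, sub_zero, ENNReal.ofReal_one, div_one]
  rw [lintegral_lintegral_swap hF.aemeasurable, ← lintegral_const_mul _ (measurable_incr t hf)]
  refine lintegral_mono fun q => ?_
  -- For fixed `q`, the admissible radii form an interval of length `8 |q.1 - q.2|`.
  calc ∫⁻ ρ in Set.Ioo (0 : ℝ) 1, F ρ q ≤ ∫⁻ ρ, F ρ q := setLIntegral_le_lintegral _ _
    _ = ∫⁻ ρ in Metric.closedBall (dist q.1 p) (4 * dist q.1 q.2), incr (t + 1) f q.1 q.2 := by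
      rw [← lintegral_indicator measurableSet_closedBall]
      refine lintegral_congr fun ρ => ?_
      simp only [F, U, Set.indicator, Metric.mem_closedBall, Set.mem_ofPred_eq, Real.dist_eq,
        abs_sub_comm]
    _ = 8 * incr t f q.1 q.2 := by
      rw [setLIntegral_const, Real.volume_closedBall, ← incr_add_one (t := t),
        ← mul_assoc 2 4, ENNReal.ofReal_mul (by norm_num), ← edist_dist, edist_eq_enorm_sub,
        mul_comm, mul_assoc]
      norm_num

open ProbabilityTheory in
/-- Local Poincaré inequality for a function vanishing on a set which meets the unit ball around
`x₀` and every circle centred at one of its points. -/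
theorem lintegral_ball_sq_le {s : ℝ} (h1 : 1 / 2 < s) (h2 : s < 1) {f : Eucl 2 → ℝ}
    (hf : Continuous f) {Z : Set (Eucl 2)} (hZ : ∀ z ∈ Z, f z = 0)
    (hcirc : ∀ p ∈ Z, ∀ ρ : ℝ, 0 < ρ → ∃ z ∈ Z, dist z p = ρ)
    {x₀ p : Eucl 2} (hp : p ∈ Z) (hpx : dist p x₀ ≤ 1) :
    ∫⁻ x in Metric.ball x₀ 1, ‖f x‖ₑ ^ 2 ≤ ENNReal.ofReal (1800 / (2 * s - 1)) *
      ∫⁻ q in Metric.ball x₀ 3 ×ˢ Metric.ball x₀ 3, incr (2 + 2 * s) f q.1 q.2 := by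
  set B := Metric.ball x₀ 3 with hB
  set J := ∫⁻ q in B ×ˢ B, incr (2 + 2 * s) f q.1 q.2 with hJ
  obtain ⟨ρ, hρ, hρJ⟩ := exists_radius_lintegral_le hf.measurable (2 + 2 * s) p (B ×ˢ B)
  obtain ⟨z, hzZ, hzp⟩ := hcirc p hp ρ hρ.1
  have hzx : dist z x₀ < 2 := by linarith [dist_triangle z p x₀, hρ.2]
  have hzB : Metric.ball z 1 ⊆ B := Metric.ball_subset_ball' (by linarith)
  have ht : 0 < 2 * s - 1 := by linarith
  have hA0 : eLpNorm f 2 (cond volume (annulus z 1)) ^ 2 ≤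
      ENNReal.ofReal (176 / (2 * s - 1)) * J := by
    refine (eLpNorm_annulus_sq_le h1 h2 hf (hZ z hzZ)).trans ?_
    rw [show 176 / (2 * s - 1) = 22 / (2 * s - 1) * 8 by ring,
      ENNReal.ofReal_mul (by positivity), mul_assoc]
    refine mul_le_mul_right ?_ _
    rw [ENNReal.ofReal_ofNat]
    refine le_trans ?_ hρJ
    rw [show 2 + 2 * s + 1 = 3 + 2 * s by ring]
    refine lintegral_mono_set fun q hq => ⟨⟨hzB hq.1, hzB hq.2.1⟩, ?_⟩
    refine le_trans ?_ hq.2.2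
    rw [← hzp]
    exact abs_dist_sub_le _ _ _
  have hvol : volume (Metric.ball x₀ 1) = ENNReal.ofReal Real.pi := by simp
  obtain ⟨e, he1, he2⟩ := eLpNorm_cond_le hf (A := Metric.ball x₀ 1) (B := annulus z 1)
    (by simp [hvol, Real.pi_pos]) (by simp [hvol])
    (volume_annulus_ne_zero z one_pos) (volume_annulus_ne_top z one_pos) (t := 2 + 2 * s) (d := 4)
    (by linarith) (by
      intro x hx y hy
      have hx' := Metric.mem_ball.1 hx
      have hy' := Metric.mem_ball.1 hy.1
      have := dist_triangle4_right x y x₀ z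
      linarith [dist_comm x₀ z, dist_triangle x x₀ y, dist_triangle x₀ z y, dist_comm z y])
  have he : e ^ 2 ≤ ENNReal.ofReal (38 / (2 * s - 1)) * J := by
    refine he2.trans (mul_le_mul' ?_ (lintegral_mono_set (Set.prod_mono ?_ ?_)))
    · rw [hvol, volume_annulus z zero_le_one, ← ENNReal.ofReal_inv_of_pos Real.pi_pos,
        ← ENNReal.ofReal_inv_of_pos (by positivity), ← ENNReal.ofReal_mul (by positivity),
        ← ENNReal.ofReal_mul (by positivity)]
      refine ENNReal.ofReal_le_ofReal ?_
      have h4 : (4 : ℝ) ^ (2 + 2 * s) ≤ 256 := by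
        calc (4 : ℝ) ^ (2 + 2 * s) ≤ 4 ^ (4 : ℝ) :=
              Real.rpow_le_rpow_of_exponent_le (by norm_num) (by linarith)
          _ = 256 := by norm_num
      have hpi : 9 ≤ Real.pi ^ 2 := by nlinarith [Real.pi_gt_three]
      calc Real.pi⁻¹ * (3 / 4 * Real.pi * 1 ^ 2)⁻¹ * 4 ^ (2 + 2 * s)
          = 4 / 3 * 4 ^ (2 + 2 * s) / Real.pi ^ 2 := by field_simp
        _ ≤ 4 / 3 * 256 / 9 := by gcongr
        _ ≤ 38 / 1 := by norm_num
        _ ≤ 38 / (2 * s - 1) := by gcongr; linarith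
    · exact Metric.ball_subset_ball (by norm_num)
    · exact fun y hy => hzB hy.1
  have hmain : eLpNorm f 2 (cond volume (Metric.ball x₀ 1)) ^ 2 ≤
      ENNReal.ofReal (428 / (2 * s - 1)) * J := by
    calc _ ≤ (eLpNorm f 2 (cond volume (annulus z 1)) + e) ^ 2 := by gcongr
      _ ≤ 2 * (ENNReal.ofReal (176 / (2 * s - 1)) * J + ENNReal.ofReal (38 / (2 * s - 1)) * J) :=
        (add_sq_le_two_mul _ _).trans (by gcongr)
      _ = _ := by
        rw [← add_mul, ← ENNReal.ofReal_add (by positivity) (by positivity), ← mul_assoc,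
          ← ENNReal.ofReal_ofNat 2, ← ENNReal.ofReal_mul (by norm_num)]
        congr 2
        ring
  have hball : ∫⁻ x in Metric.ball x₀ 1, ‖f x‖ₑ ^ 2 =
      ENNReal.ofReal Real.pi * eLpNorm f 2 (cond volume (Metric.ball x₀ 1)) ^ 2 := by
    rw [eLpNorm_two_sq, ProbabilityTheory.cond, lintegral_smul_measure, smul_eq_mul, hvol,
      ← mul_assoc, ENNReal.mul_inv_cancel (by simp [Real.pi_pos]) ENNReal.ofReal_ne_top, one_mul]
  rw [hball]
  calc _ ≤ ENNReal.ofReal Real.pi * (ENNReal.ofReal (428 / (2 * s - 1)) * J) := by gcongr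
    _ ≤ _ := by
      rw [← mul_assoc, ← ENNReal.ofReal_mul Real.pi_pos.le]
      gcongr
      rw [mul_div_assoc']
      gcongr
      nlinarith [Real.pi_lt_d2]

/-- Global Poincaré inequality, with differences of length less than `6` only. -/
theorem lintegral_sq_le_of_circles {s : ℝ} (h1 : 1 / 2 < s) (h2 : s < 1) {f : Eucl 2 → ℝ}
    (hf : Continuous f) {Z : Set (Eucl 2)} (hZ : ∀ z ∈ Z, f z = 0)
    (hcirc : ∀ p ∈ Z, ∀ ρ : ℝ, 0 < ρ → ∃ z ∈ Z, dist z p = ρ)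
    (hdense : ∀ x, ∃ p ∈ Z, dist p x ≤ 1) :
    ∫⁻ x, ‖f x‖ₑ ^ 2 ≤ ENNReal.ofReal (16200 / (2 * s - 1)) *
      ∫⁻ q in {q : Eucl 2 × Eucl 2 | dist q.1 q.2 < 6}, incr (2 + 2 * s) f q.1 q.2 := by
  set G : Eucl 2 × Eucl 2 → ℝ≥0∞ := fun q => incr (2 + 2 * s) f q.1 q.2 with hG
  have hGm : Measurable G := measurable_incr _ hf.measurable
  set I := ∫⁻ q in {q : Eucl 2 × Eucl 2 | dist q.1 q.2 < 6}, G q with hI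
  -- Both sides of the local inequality are averaged over the centre `x₀`.
  have hlocal : ∫⁻ x₀, ∫⁻ x in Metric.ball x₀ 1, ‖f x‖ₑ ^ 2 ≤
      ∫⁻ x₀, ENNReal.ofReal (1800 / (2 * s - 1)) *
        ∫⁻ q in Metric.ball x₀ 3 ×ˢ Metric.ball x₀ 3, G q :=
    lintegral_mono fun x₀ => by
      obtain ⟨p, hp, hpx⟩ := hdense x₀
      exact lintegral_ball_sq_le h1 h2 hf hZ hcirc hp hpx
  have hleft : ∫⁻ x₀, ∫⁻ x in Metric.ball x₀ 1, ‖f x‖ₑ ^ 2 =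
      ENNReal.ofReal Real.pi * ∫⁻ x, ‖f x‖ₑ ^ 2 := by
    let U : Set (Eucl 2 × Eucl 2) := {w | dist w.2 w.1 < 1}
    have hU : MeasurableSet U := (isOpen_lt (by fun_prop) (by fun_prop)).measurableSet
    have hm : Measurable (U.indicator fun w => ‖f w.2‖ₑ ^ 2) :=
      ((hf.measurable.comp measurable_snd).enorm.pow_const 2).indicator hU
    calc ∫⁻ x₀, ∫⁻ x in Metric.ball x₀ 1, ‖f x‖ₑ ^ 2
        = ∫⁻ x₀, ∫⁻ x, U.indicator (fun w => ‖f w.2‖ₑ ^ 2) (x₀, x) := by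
          refine lintegral_congr fun x₀ => ?_
          rw [← lintegral_indicator measurableSet_ball]
          rfl
      _ = ∫⁻ x, ∫⁻ x₀, U.indicator (fun w => ‖f w.2‖ₑ ^ 2) (x₀, x) :=
          lintegral_lintegral_swap hm.aemeasurable
      _ = ∫⁻ x, ∫⁻ _ in Metric.ball x 1, ‖f x‖ₑ ^ 2 := by
          refine lintegral_congr fun x => ?_
          rw [← lintegral_indicator measurableSet_ball]
          refine lintegral_congr fun x₀ => ?_
          simp only [U, Set.indicator, Metric.mem_ball, Set.mem_ofPred_eq, dist_comm]
      _ = _ := by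
          rw [← lintegral_const_mul _ (hf.measurable.enorm.pow_const 2)]
          refine lintegral_congr fun x => ?_
          rw [setLIntegral_const, mul_comm]
          simp
  have hright : ∫⁻ x₀, ∫⁻ q in Metric.ball x₀ 3 ×ˢ Metric.ball x₀ 3, G q ≤
      ENNReal.ofReal (9 * Real.pi) * I := by
    let U : Set (Eucl 2 × (Eucl 2 × Eucl 2)) := {w | dist w.2.1 w.1 < 3 ∧ dist w.2.2 w.1 < 3}
    have hU : MeasurableSet U := by
      have h3 : IsOpen {w : Eucl 2 × (Eucl 2 × Eucl 2) | dist w.2.1 w.1 < 3} :=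
        isOpen_lt (by fun_prop) (by fun_prop)
      have h4 : IsOpen {w : Eucl 2 × (Eucl 2 × Eucl 2) | dist w.2.2 w.1 < 3} :=
        isOpen_lt (by fun_prop) (by fun_prop)
      exact (h3.inter h4).measurableSet
    have hm : Measurable (U.indicator fun w => G w.2) := (hGm.comp measurable_snd).indicator hU
    have hm6 : MeasurableSet {q : Eucl 2 × Eucl 2 | dist q.1 q.2 < 6} :=
      (isOpen_lt (by fun_prop) (by fun_prop)).measurableSet
    calc ∫⁻ x₀, ∫⁻ q in Metric.ball x₀ 3 ×ˢ Metric.ball x₀ 3, G q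
        = ∫⁻ x₀, ∫⁻ q, U.indicator (fun w => G w.2) (x₀, q) := by
          refine lintegral_congr fun x₀ => ?_
          rw [← lintegral_indicator (measurableSet_ball.prod measurableSet_ball)]
          rfl
      _ = ∫⁻ q, ∫⁻ x₀, U.indicator (fun w => G w.2) (x₀, q) :=
          lintegral_lintegral_swap hm.aemeasurable
      _ ≤ ∫⁻ q, {q : Eucl 2 × Eucl 2 | dist q.1 q.2 < 6}.indicator
            (fun q => ENNReal.ofReal (9 * Real.pi) * G q) q := by
          refine lintegral_mono fun q => ?_
          by_cases hq : dist q.1 q.2 < 6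
          · rw [Set.indicator_of_mem (show q ∈ {q : Eucl 2 × Eucl 2 | dist q.1 q.2 < 6} from hq)]
            calc ∫⁻ x₀, U.indicator (fun w => G w.2) (x₀, q)
                ≤ ∫⁻ x₀, (Metric.ball q.1 3).indicator (fun _ => G q) x₀ := by
                  refine lintegral_mono fun x₀ => ?_
                  refine Set.indicator_le_indicator_of_subset (s := {x₀ | (x₀, q) ∈ U})
                    (f := fun _ => G q) (fun y hy => ?_) (fun _ => zero_le) x₀
                  rw [Metric.mem_ball, dist_comm]
                  exact hy.1
              _ = _ := by
                  rw [lintegral_indicator measurableSet_ball, setLIntegral_const, mul_comm,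
                    EuclideanSpace.volume_ball_fin_two, ← ENNReal.ofReal_pow (by norm_num),
                    ← ENNReal.ofReal_mul (by norm_num)]
                  norm_num
          · have : ∀ x₀, U.indicator (fun w => G w.2) (x₀, q) = 0 := fun x₀ =>
              Set.indicator_of_notMem (fun h => hq (by
                linarith [dist_triangle_right q.1 q.2 x₀, h.1, h.2])) _
            simp [this]
      _ = _ := by
          rw [lintegral_indicator hm6, lintegral_const_mul _ hGm]
  rw [hleft, lintegral_const_mul' _ _ ENNReal.ofReal_ne_top] at hlocal
  have hs : 0 < 2 * s - 1 := by linarith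
  have hpi0 : ENNReal.ofReal Real.pi ≠ 0 := by simp [Real.pi_pos]
  rw [← ENNReal.mul_le_mul_iff_right hpi0 ENNReal.ofReal_ne_top]
  refine hlocal.trans ((mul_le_mul_right hright _).trans_eq ?_)
  rw [← mul_assoc, ← mul_assoc, ← ENNReal.ofReal_mul (by positivity),
    ← ENNReal.ofReal_mul (by positivity)]
  congr 2
  ring

/-! ### Uniformity as `s` tends to `1` -/

/-- The squared `L²` norm of the translation difference `f (· + h) - f`. -/
noncomputable def diffSq (f : Eucl 2 → ℝ) (h : Eucl 2) : ℝ≥0∞ := ∫⁻ x, ‖f (x + h) - f x‖ₑ ^ 2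

theorem lintegral_diff_mul_eq {f : Eucl 2 → ℝ} (hf : Measurable f) {K : Eucl 2 → ℝ≥0∞}
    (hK : Measurable K) :
    ∫⁻ x, ∫⁻ y, ‖f x - f y‖ₑ ^ 2 * K (y - x) = ∫⁻ h, diffSq f h * K h := by
  have hm : Measurable (Function.uncurry fun x h : Eucl 2 => ‖f (x + h) - f x‖ₑ ^ 2 * K h) := by
    have h1 : Measurable fun q : Eucl 2 × Eucl 2 => f (q.1 + q.2) :=
      hf.comp (measurable_fst.add measurable_snd)
    have h2 : Measurable fun q : Eucl 2 × Eucl 2 => f q.1 := hf.comp measurable_fst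
    exact ((h1.sub h2).enorm.pow_const 2).mul (hK.comp measurable_snd)
  calc ∫⁻ x, ∫⁻ y, ‖f x - f y‖ₑ ^ 2 * K (y - x)
      = ∫⁻ x, ∫⁻ h, ‖f (x + h) - f x‖ₑ ^ 2 * K h := by
        refine lintegral_congr fun x => ?_
        rw [← lintegral_add_left_eq_self _ x]
        refine lintegral_congr fun h => ?_
        rw [add_sub_cancel_left, ← enorm_neg (f x - f (x + h)), neg_sub]
    _ = ∫⁻ h, ∫⁻ x, ‖f (x + h) - f x‖ₑ ^ 2 * K h := lintegral_lintegral_swap hm.aemeasurable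
    _ = _ := by
        refine lintegral_congr fun h => ?_
        rw [lintegral_mul_const _ (by fun_prop), diffSq]

theorem gagliardoSq_eq_lintegral_diffSq (s : ℝ) {f : Eucl 2 → ℝ} (hf : Measurable f) :
    gagliardoSq s f = ∫⁻ h, diffSq f h / ‖h‖ₑ ^ (2 + 2 * s) := by
  simp_rw [gagliardoSq, div_eq_mul_inv]
  rw [← lintegral_diff_mul_eq hf (K := fun h => (‖h‖ₑ ^ (2 + 2 * s))⁻¹) (by fun_prop)]
  refine lintegral_congr fun x => lintegral_congr fun y => ?_
  rw [← enorm_neg (x - y), neg_sub]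
  norm_num

theorem lintegral_incr_eq_lintegral_diffSq (t : ℝ) {f : Eucl 2 → ℝ} (hf : Measurable f) (R : ℝ) :
    ∫⁻ q in {q : Eucl 2 × Eucl 2 | dist q.1 q.2 < R}, incr t f q.1 q.2 =
      ∫⁻ h in Metric.ball 0 R, diffSq f h / ‖h‖ₑ ^ t := by
  have hm : MeasurableSet {q : Eucl 2 × Eucl 2 | dist q.1 q.2 < R} :=
    (isOpen_lt (by fun_prop) (by fun_prop)).measurableSet
  rw [← lintegral_indicator hm, ← lintegral_indicator measurableSet_ball, Measure.volume_eq_prod,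
    lintegral_prod _ ((measurable_incr t hf).indicator hm).aemeasurable]
  have hK : Measurable ((Metric.ball (0 : Eucl 2) R).indicator fun h => (‖h‖ₑ ^ t)⁻¹) :=
    Measurable.indicator (by fun_prop) measurableSet_ball
  refine Eq.trans ?_ ((lintegral_diff_mul_eq hf hK).trans ?_)
  · refine lintegral_congr fun x => lintegral_congr fun y => ?_
    by_cases h : dist x y < R
    · rw [Set.indicator_of_mem (by exact h), Set.indicator_of_mem
        (by rwa [mem_ball_zero_iff, ← dist_eq_norm, dist_comm]), incr, div_eq_mul_inv,
        ← enorm_neg (x - y), neg_sub]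
    · rw [Set.indicator_of_notMem (by exact h), Set.indicator_of_notMem
        (by rwa [mem_ball_zero_iff, ← dist_eq_norm, dist_comm]), mul_zero]
  · refine lintegral_congr fun h => ?_
    by_cases hh : h ∈ Metric.ball (0 : Eucl 2) R
    · simp only [Set.indicator_of_mem hh, div_eq_mul_inv]
    · simp only [Set.indicator_of_notMem hh, mul_zero]

/-- Doubling the step costs a factor `4`: this is what produces the factor `1 - s`. -/
theorem diffSq_two_smul_le {f : Eucl 2 → ℝ} (hf : Measurable f) (h : Eucl 2) :
    diffSq f ((2 : ℝ) • h) ≤ 4 * diffSq f h := by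
  have hm : Measurable fun x => ‖f (x + h) - f x‖ₑ ^ 2 := by fun_prop
  calc diffSq f ((2 : ℝ) • h)
      ≤ ∫⁻ x, 2 * (‖f (x + h + h) - f (x + h)‖ₑ ^ 2 + ‖f (x + h) - f x‖ₑ ^ 2) := by
        refine lintegral_mono fun x => le_trans ?_ (add_sq_le_two_mul _ _)
        gcongr
        rw [two_smul, ← add_assoc]
        refine le_trans (le_of_eq ?_) (enorm_add_le _ _)
        rw [sub_add_sub_cancel]
    _ = 2 * (diffSq f h + diffSq f h) := by
        rw [lintegral_const_mul _ (by fun_prop), lintegral_add_right _ hm,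
          lintegral_add_right_eq_self (fun x => ‖f (x + h) - f x‖ₑ ^ 2) h, diffSq]
    _ = _ := by ring

theorem lintegral_eq_mul_lintegral_smul {c : ℝ} (hc : 0 < c) (g : Eucl 2 → ℝ≥0∞) :
    ∫⁻ x, g x = ENNReal.ofReal (c ^ 2) * ∫⁻ x, g (c • x) := by
  have h := Measure.map_addHaar_smul (volume : Measure (Eucl 2)) hc.ne'
  have he : MeasurableEmbedding fun x : Eucl 2 => c • x :=
    (Homeomorph.smulOfNeZero c hc.ne').measurableEmbedding
  have h2 : ∫⁻ x, g (c • x) = ∫⁻ x, g x ∂(Measure.map (fun x => c • x) volume) :=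
    (he.lintegral_map g).symm
  rw [h2, h, lintegral_smul_measure, smul_eq_mul, ← mul_assoc, ← ENNReal.ofReal_mul (by positivity)]
  simp only [finrank_euclideanSpace, Fintype.card_fin]
  rw [abs_of_pos (by positivity), mul_inv_cancel₀ (by positivity), ENNReal.ofReal_one, one_mul]

theorem smul_mem_annulus_zero_iff {c : ℝ} (hc : 0 < c) (r : ℝ) (x : Eucl 2) :
    c • x ∈ annulus 0 (c * r) ↔ x ∈ annulus 0 r := by
  simp only [annulus, Set.mem_sdiff, mem_ball_zero_iff, norm_smul, Real.norm_eq_abs, abs_of_pos hc,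
    mul_div_assoc, mul_lt_mul_iff_right₀ hc]

/-- The part of the seminorm coming from differences of length about `r` decreases at most by the
factor `4^{-(1-s)}` when `r` is halved. -/
theorem lintegral_annulus_half_ge (s : ℝ) {f : Eucl 2 → ℝ} (hf : Measurable f) (r : ℝ) :
    ENNReal.ofReal ((1 / 4 : ℝ) ^ (1 - s)) *
      ∫⁻ h in annulus 0 r, diffSq f h / ‖h‖ₑ ^ (2 + 2 * s) ≤
    ∫⁻ h in annulus 0 (1 / 2 * r), diffSq f h / ‖h‖ₑ ^ (2 + 2 * s) := by
  rw [← lintegral_indicator (measurableSet_annulus _ _),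
    ← lintegral_indicator (measurableSet_annulus _ _),
    lintegral_eq_mul_lintegral_smul (c := 1 / 2) (by norm_num)
      ((annulus 0 (1 / 2 * r)).indicator _),
    ← lintegral_const_mul' _ _ ENNReal.ofReal_ne_top,
    ← lintegral_const_mul' _ _ ENNReal.ofReal_ne_top]
  refine lintegral_mono fun h => ?_
  by_cases hh : h ∈ annulus 0 r
  · rw [Set.indicator_of_mem hh, Set.indicator_of_mem
      ((smul_mem_annulus_zero_iff (by norm_num) r h).2 hh), enorm_smul,
      ENNReal.mul_rpow_of_ne_top (by simp) (by simp)]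
    have h2 : diffSq f h ≤ 4 * diffSq f ((1 / 2 : ℝ) • h) := by
      refine le_trans (le_of_eq ?_) (diffSq_two_smul_le hf _)
      rw [smul_smul]; norm_num
    have hhalf : ‖(1 / 2 : ℝ)‖ₑ ^ (2 + 2 * s) = ENNReal.ofReal ((1 / 2 : ℝ) ^ (2 + 2 * s)) := by
      rw [Real.enorm_eq_ofReal (by norm_num), ENNReal.ofReal_rpow_of_pos (by norm_num)]
    have hpos : 0 < (1 / 2 : ℝ) ^ (2 + 2 * s) := by positivity
    have hcoef : (1 / 4 : ℝ) ^ (1 - s) * 4 = (1 / 2) ^ 2 * ((1 / 2 : ℝ) ^ (2 + 2 * s))⁻¹ := by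
      rw [← Real.rpow_neg (by norm_num), show (1 / 4 : ℝ) = (1 / 2) ^ (2 : ℝ) by norm_num,
        ← Real.rpow_mul (by norm_num), show (4 : ℝ) = (1 / 2) ^ (-2 : ℝ) by
          rw [Real.rpow_neg (by norm_num)]; norm_num,
        ← Real.rpow_natCast, ← Real.rpow_add (by norm_num), ← Real.rpow_add (by norm_num)]
      congr 1
      push_cast
      ring
    rw [hhalf, div_eq_mul_inv (diffSq f h), div_eq_mul_inv (diffSq f _),
      ENNReal.mul_inv (Or.inl (by simpa using hpos)) (Or.inl ENNReal.ofReal_ne_top),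
      ← ENNReal.ofReal_inv_of_pos hpos]
    calc _ ≤ ENNReal.ofReal ((1 / 4 : ℝ) ^ (1 - s)) *
          (4 * diffSq f ((1 / 2 : ℝ) • h) * (‖h‖ₑ ^ (2 + 2 * s))⁻¹) := by gcongr
      _ = ENNReal.ofReal ((1 / 4 : ℝ) ^ (1 - s) * 4) *
          (diffSq f ((1 / 2 : ℝ) • h) * (‖h‖ₑ ^ (2 + 2 * s))⁻¹) := by
        rw [ENNReal.ofReal_mul (by positivity), ENNReal.ofReal_ofNat]
        ring
      _ = _ := by
        rw [hcoef, ENNReal.ofReal_mul (by positivity)]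
        ring
  · simp [Set.indicator_of_notMem hh]

theorem lintegral_ball_eq_tsum_annulus (g : Eucl 2 → ℝ≥0∞) {r : ℝ} (hr : 0 < r) :
    ∫⁻ h in Metric.ball 0 r, g h = ∑' i : ℕ, ∫⁻ h in annulus 0 ((1 / 2) ^ i * r), g h := by
  have hdis : Pairwise (Function.onFun Disjoint fun i : ℕ =>
      annulus (0 : Eucl 2) ((1 / 2) ^ i * r)) := by
    have key : ∀ i j : ℕ, i < j → Disjoint (annulus (0 : Eucl 2) ((1 / 2) ^ i * r))
        (annulus (0 : Eucl 2) ((1 / 2) ^ j * r)) := by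
      intro i j hij
      refine disjoint_annulus 0 ?_
      have h3 : (1 / 2 : ℝ) ^ j ≤ (1 / 2) ^ (i + 1) :=
        pow_le_pow_of_le_one (by norm_num) (by norm_num) hij
      rw [pow_succ] at h3
      nlinarith
    intro i j hij
    rcases lt_or_gt_of_ne hij with h | h
    · exact key i j h
    · exact (key j i h).symm
  rw [← lintegral_iUnion (fun i => measurableSet_annulus _ _) hdis]
  refine setLIntegral_congr ?_
  have hU : (⋃ i : ℕ, annulus (0 : Eucl 2) ((1 / 2) ^ i * r)) = Metric.ball 0 r \ {0} := by
    ext h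
    simp only [Set.mem_iUnion, annulus, Set.mem_sdiff, mem_ball_zero_iff, not_lt,
      Set.mem_singleton_iff]
    constructor
    · rintro ⟨i, hi1, hi2⟩
      have hp : 0 < (1 / 2 : ℝ) ^ i * r := by positivity
      have hle : (1 / 2 : ℝ) ^ i ≤ 1 := pow_le_one₀ (by norm_num) (by norm_num)
      refine ⟨by nlinarith, ?_⟩
      rintro rfl
      rw [norm_zero] at hi2
      linarith
    · rintro ⟨hlt, hne⟩
      have hn : 0 < ‖h‖ := norm_pos_iff.2 hne
      have hex : ∃ i : ℕ, (1 / 2 : ℝ) ^ i * r / 2 ≤ ‖h‖ := by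
        obtain ⟨n, hn⟩ := exists_pow_lt_of_lt_one (div_pos hn hr) (y := (1 / 2 : ℝ)) (by norm_num)
        refine ⟨n, ?_⟩
        have : (1 / 2 : ℝ) ^ n * r < ‖h‖ := (lt_div_iff₀ hr).1 hn
        have hp : 0 < (1 / 2 : ℝ) ^ n * r := by positivity
        linarith
      classical
      refine ⟨Nat.find hex, ?_, Nat.find_spec hex⟩
      rcases Nat.eq_zero_or_pos (Nat.find hex) with h0 | h0
      · rw [h0]; simpa using hlt
      · have := Nat.find_min hex (Nat.sub_lt h0 one_pos)
        rw [not_le] at this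
        refine this.trans_eq ?_
        obtain ⟨k, hk⟩ := Nat.exists_eq_succ_of_ne_zero h0.ne'
        rw [hk, Nat.succ_eq_add_one, Nat.add_sub_cancel, pow_succ]
        ring
  rw [hU]
  exact (sdiff_null_ae_eq_self (measure_singleton _)).symm

/-- Each shell carries at most a fraction `O(1 - s)` of the seminorm. -/
theorem lintegral_annulus_le {s : ℝ} (hs : s < 1) {f : Eucl 2 → ℝ} (hf : Measurable f) {r : ℝ}
    (hr : 0 < r) :
    ∫⁻ h in annulus 0 r, diffSq f h / ‖h‖ₑ ^ (2 + 2 * s) ≤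
      ENNReal.ofReal (2 * (1 - s)) * ∫⁻ h in Metric.ball 0 r, diffSq f h / ‖h‖ₑ ^ (2 + 2 * s) := by
  set a := ENNReal.ofReal ((1 / 4 : ℝ) ^ (1 - s)) with ha
  set I : ℕ → ℝ≥0∞ := fun i =>
    ∫⁻ h in annulus 0 ((1 / 2) ^ i * r), diffSq f h / ‖h‖ₑ ^ (2 + 2 * s) with hI
  -- The shells inside `|h| < r` contribute at least `∑ aⁱ = 1 / (1 - a)` times the outermost one.
  have hstep : ∀ i, a ^ i * I 0 ≤ I i := by
    intro i
    induction i with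
    | zero => simp
    | succ i ih =>
      calc a ^ (i + 1) * I 0 = a * (a ^ i * I 0) := by ring
        _ ≤ a * I i := by gcongr
        _ ≤ ∫⁻ h in annulus 0 (1 / 2 * ((1 / 2) ^ i * r)), diffSq f h / ‖h‖ₑ ^ (2 + 2 * s) :=
          lintegral_annulus_half_ge s hf _
        _ = I (i + 1) := by
          simp only [hI]
          rw [show (1 / 2 : ℝ) * ((1 / 2) ^ i * r) = (1 / 2) ^ (i + 1) * r by ring]
  have hsum : (1 - a)⁻¹ * I 0 ≤
      ∫⁻ h in Metric.ball 0 r, diffSq f h / ‖h‖ₑ ^ (2 + 2 * s) := by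
    rw [lintegral_ball_eq_tsum_annulus _ hr, ← ENNReal.tsum_geometric, ← ENNReal.tsum_mul_right]
    exact ENNReal.tsum_le_tsum hstep
  have ha1 : (1 / 4 : ℝ) ^ (1 - s) < 1 :=
    Real.rpow_lt_one (by norm_num) (by norm_num) (by linarith)
  have h1a : 1 - a ≠ 0 := by
    rw [ha, ← ENNReal.ofReal_one, ← ENNReal.ofReal_sub _ (by positivity)]
    simpa using ha1
  have h1a' : 1 - a ≠ ∞ := by simp
  have hle : 1 - a ≤ ENNReal.ofReal (2 * (1 - s)) := by
    rw [ha, ← ENNReal.ofReal_one, ← ENNReal.ofReal_sub _ (by positivity)]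
    refine ENNReal.ofReal_le_ofReal ?_
    have hlog : Real.log (1 / 4) ≥ -2 := by
      rw [one_div, Real.log_inv, show (4 : ℝ) = 2 ^ 2 by norm_num, Real.log_pow]
      have := Real.log_two_lt_d9
      push_cast
      linarith
    have hexp := Real.add_one_le_exp (Real.log (1 / 4) * (1 - s))
    rw [Real.rpow_def_of_pos (by norm_num)]
    nlinarith
  calc ∫⁻ h in annulus 0 r, diffSq f h / ‖h‖ₑ ^ (2 + 2 * s) = I 0 := by simp [hI]
    _ = (1 - a) * ((1 - a)⁻¹ * I 0) := by
      rw [← mul_assoc, ENNReal.mul_inv_cancel h1a h1a', one_mul]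
    _ ≤ _ := by gcongr

theorem lintegral_annulus_le_of_le {σ s : ℝ} (hσ : σ ≤ s) (f : Eucl 2 → ℝ) {r : ℝ} (hr : 0 < r) :
    ∫⁻ h in annulus 0 r, diffSq f h / ‖h‖ₑ ^ (2 + 2 * σ) ≤
      ENNReal.ofReal (r ^ (2 * (s - σ))) *
        ∫⁻ h in annulus 0 r, diffSq f h / ‖h‖ₑ ^ (2 + 2 * s) := by
  rw [← lintegral_const_mul' _ _ ENNReal.ofReal_ne_top]
  refine setLIntegral_mono' (measurableSet_annulus _ _) fun h hh => ?_
  have h0 : 0 < ‖h‖ := by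
    have := hh.2
    rw [mem_ball_zero_iff, not_lt] at this
    linarith
  have hr' : ‖h‖ ≤ r := (mem_ball_zero_iff.1 hh.1).le
  have hpow : ∀ t : ℝ, ‖h‖ₑ ^ t = ENNReal.ofReal (‖h‖ ^ t) := fun t => by
    rw [← ofReal_norm, ENNReal.ofReal_rpow_of_pos h0]
  rw [hpow, hpow, div_eq_mul_inv, div_eq_mul_inv, ← ENNReal.ofReal_inv_of_pos (by positivity),
    ← ENNReal.ofReal_inv_of_pos (by positivity), mul_left_comm,
    ← ENNReal.ofReal_mul (by positivity)]
  refine mul_le_mul_right (ENNReal.ofReal_le_ofReal ?_) _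
  rw [← div_eq_mul_inv, inv_le_iff_one_le_mul₀ (by positivity), div_mul_eq_mul_div,
    one_le_div (by positivity)]
  calc ‖h‖ ^ (2 + 2 * s) = ‖h‖ ^ (2 * (s - σ)) * ‖h‖ ^ (2 + 2 * σ) := by
        rw [← Real.rpow_add h0]; congr 1; ring
    _ ≤ _ := by gcongr

/-- The truncated seminorm of order `5/8` is controlled by `(1 - s)` times the truncated seminorm
of order `s`, uniformly as `s → 1`. -/
theorem lintegral_ball_five_eighths_le {s : ℝ} (h1 : 3 / 4 ≤ s) (h2 : s < 1) {f : Eucl 2 → ℝ}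
    (hf : Measurable f) :
    ∫⁻ h in Metric.ball 0 6, diffSq f h / ‖h‖ₑ ^ (2 + 2 * (5 / 8 : ℝ)) ≤
      ENNReal.ofReal (84 * (1 - s)) *
        ∫⁻ h in Metric.ball 0 6, diffSq f h / ‖h‖ₑ ^ (2 + 2 * s) := by
  set T := ∫⁻ h in Metric.ball 0 6, diffSq f h / ‖h‖ₑ ^ (2 + 2 * s) with hT
  set q : ℝ := (1 / 2 : ℝ) ^ (1 / 4 : ℝ) with hq
  have hq0 : 0 ≤ q := by positivity
  have hq1 : q ≤ 6 / 7 := by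
    refine le_of_pow_le_pow_left₀ (n := 4) (by norm_num) (by norm_num) ?_
    rw [hq, ← Real.rpow_natCast, ← Real.rpow_mul (by norm_num)]
    norm_num
  have hi : ∀ i : ℕ, ∫⁻ h in annulus 0 ((1 / 2) ^ i * 6),
      diffSq f h / ‖h‖ₑ ^ (2 + 2 * (5 / 8 : ℝ)) ≤
        ENNReal.ofReal q ^ i * (ENNReal.ofReal (12 * (1 - s)) * T) := by
    intro i
    have hr0 : 0 < (1 / 2 : ℝ) ^ i * 6 := by positivity
    have hle1 : (1 / 2 : ℝ) ^ i ≤ 1 := pow_le_one₀ (by norm_num) (by norm_num)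
    refine (lintegral_annulus_le_of_le (σ := 5 / 8) (s := s) (by linarith) f hr0).trans ?_
    have hc : ((1 / 2 : ℝ) ^ i * 6) ^ (2 * (s - 5 / 8)) ≤ q ^ i * 6 := by
      rw [Real.mul_rpow (by positivity) (by norm_num)]
      gcongr
      · calc ((1 / 2 : ℝ) ^ i) ^ (2 * (s - 5 / 8)) ≤ ((1 / 2 : ℝ) ^ i) ^ (1 / 4 : ℝ) :=
              Real.rpow_le_rpow_of_exponent_ge (by positivity) hle1 (by linarith)
          _ = q ^ i := by
              rw [hq, ← Real.rpow_natCast, ← Real.rpow_natCast, ← Real.rpow_mul (by norm_num),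
                ← Real.rpow_mul (by norm_num), mul_comm]
      · calc (6 : ℝ) ^ (2 * (s - 5 / 8)) ≤ 6 ^ (1 : ℝ) :=
              Real.rpow_le_rpow_of_exponent_le (by norm_num) (by linarith)
          _ = 6 := Real.rpow_one 6
    have hball : Metric.ball (0 : Eucl 2) ((1 / 2) ^ i * 6) ⊆ Metric.ball 0 6 :=
      Metric.ball_subset_ball (by linarith)
    calc _ ≤ ENNReal.ofReal (q ^ i * 6) * (ENNReal.ofReal (2 * (1 - s)) * T) := by
          refine mul_le_mul' (ENNReal.ofReal_le_ofReal hc)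
            ((lintegral_annulus_le h2 hf hr0).trans ?_)
          exact mul_le_mul_right (lintegral_mono_set hball) _
      _ = _ := by
          rw [← ENNReal.ofReal_pow hq0, ← mul_assoc, ← mul_assoc,
            ← ENNReal.ofReal_mul (by positivity), ← ENNReal.ofReal_mul (by positivity)]
          congr 2
          ring
  rw [lintegral_ball_eq_tsum_annulus _ (by norm_num)]
  refine (ENNReal.tsum_le_tsum hi).trans ?_
  rw [ENNReal.tsum_mul_right, ENNReal.tsum_geometric, ← mul_assoc]
  refine mul_le_mul_left ?_ _
  have h7 : (1 - ENNReal.ofReal q)⁻¹ ≤ ENNReal.ofReal 7 := by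
    rw [← ENNReal.ofReal_one, ← ENNReal.ofReal_sub _ hq0,
      ← ENNReal.ofReal_inv_of_pos (by linarith)]
    refine ENNReal.ofReal_le_ofReal ?_
    rw [inv_le_comm₀ (by linarith) (by norm_num)]
    linarith
  refine (mul_le_mul_left h7 _).trans (le_of_eq ?_)
  rw [← ENNReal.ofReal_mul (by norm_num)]
  congr 1
  ring

/-- Fractional Poincaré inequality, at scale `1`, for a function vanishing on a set which meets
every unit ball and every circle centred at one of its points. The constant has the sharp
behaviour both as `s → 1/2` and as `s → 1`. -/
theorem lintegral_sq_le_gagliardoSq {s : ℝ} (h1 : 1 / 2 < s) (h2 : s < 1) {f : Eucl 2 → ℝ}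
    (hf : Continuous f) {Z : Set (Eucl 2)} (hZ : ∀ z ∈ Z, f z = 0)
    (hcirc : ∀ p ∈ Z, ∀ ρ : ℝ, 0 < ρ → ∃ z ∈ Z, dist z p = ρ)
    (hdense : ∀ x, ∃ p ∈ Z, dist p x ≤ 1) :
    ∫⁻ x, ‖f x‖ₑ ^ 2 ≤ ENNReal.ofReal (5443200 * ((1 - s) / (2 * s - 1))) * gagliardoSq s f := by
  have key : ∀ σ : ℝ, 1 / 2 < σ → σ < 1 → ∫⁻ x, ‖f x‖ₑ ^ 2 ≤
      ENNReal.ofReal (16200 / (2 * σ - 1)) *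
        ∫⁻ h in Metric.ball 0 6, diffSq f h / ‖h‖ₑ ^ (2 + 2 * σ) := fun σ hσ1 hσ2 => by
    rw [← lintegral_incr_eq_lintegral_diffSq _ hf.measurable]
    exact lintegral_sq_le_of_circles hσ1 hσ2 hf hZ hcirc hdense
  have hT : ∫⁻ h in Metric.ball 0 6, diffSq f h / ‖h‖ₑ ^ (2 + 2 * s) ≤ gagliardoSq s f := by
    rw [gagliardoSq_eq_lintegral_diffSq s hf.measurable]
    exact setLIntegral_le_lintegral _ _
  have hs : 0 < 2 * s - 1 := by linarith
  -- For `s ≥ 3/4` the inequality of order `5/8` is combined with `lintegral_ball_five_eighths_le`.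
  rcases le_total s (3 / 4) with h3 | h3
  · refine (key s h1 h2).trans (mul_le_mul' (ENNReal.ofReal_le_ofReal ?_) hT)
    rw [mul_div_assoc']
    gcongr
    linarith
  · refine (key (5 / 8) (by norm_num) (by norm_num)).trans ?_
    refine (mul_le_mul_right (lintegral_ball_five_eighths_le h3 h2 hf.measurable) _).trans ?_
    rw [← mul_assoc, ← ENNReal.ofReal_mul (by norm_num)]
    refine mul_le_mul' (ENNReal.ofReal_le_ofReal ?_) hT
    have h4 : 1 - s ≤ (1 - s) / (2 * s - 1) := by
      rw [le_div_iff₀ hs]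
      nlinarith
    norm_num
    linarith

theorem diffSq_comp_smul {R : ℝ} (hR : 0 < R) (f : Eucl 2 → ℝ) (h : Eucl 2) :
    ENNReal.ofReal (R ^ 2) * diffSq (fun x => f (R • x)) h = diffSq f (R • h) := by
  rw [diffSq, diffSq, lintegral_eq_mul_lintegral_smul hR (fun x => ‖f (x + R • h) - f x‖ₑ ^ 2)]
  simp only [smul_add]

theorem gagliardoSq_comp_smul (s : ℝ) {R : ℝ} (hR : 0 < R) {f : Eucl 2 → ℝ} (hf : Measurable f) :
    ENNReal.ofReal (R ^ 2) * gagliardoSq s (fun x => f (R • x)) =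
      ENNReal.ofReal (R ^ (2 * s)) * gagliardoSq s f := by
  rw [gagliardoSq_eq_lintegral_diffSq s (by fun_prop), gagliardoSq_eq_lintegral_diffSq s hf,
    lintegral_eq_mul_lintegral_smul hR (fun h => diffSq f h / _), ← mul_assoc,
    ← ENNReal.ofReal_mul (by positivity), ← lintegral_const_mul' _ _ ENNReal.ofReal_ne_top,
    ← lintegral_const_mul' _ _ ENNReal.ofReal_ne_top]
  refine lintegral_congr fun h => ?_
  have hpos : 0 < R ^ (2 + 2 * s) := by positivity
  rw [← mul_div_assoc, diffSq_comp_smul hR, enorm_smul,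
    ENNReal.mul_rpow_of_ne_top (by simp) (by simp), Real.enorm_eq_ofReal hR.le,
    ENNReal.ofReal_rpow_of_pos hR, div_eq_mul_inv, div_eq_mul_inv,
    ENNReal.mul_inv (Or.inl (by simpa using hpos)) (Or.inl ENNReal.ofReal_ne_top),
    ← ENNReal.ofReal_inv_of_pos hpos]
  have hone : ENNReal.ofReal (R ^ (2 * s) * R ^ 2) * ENNReal.ofReal (R ^ (2 + 2 * s))⁻¹ = 1 := by
    rw [← ENNReal.ofReal_mul (by positivity), ← ENNReal.ofReal_one, Real.rpow_add hR,
      Real.rpow_two]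
    congr 1
    field_simp
  calc _ = diffSq f (R • h) * (‖h‖ₑ ^ (2 + 2 * s))⁻¹ * 1 := (mul_one _).symm
    _ = _ := by
      rw [← hone]
      ring

/-- The fractional Poincaré inequality at scale `R`, by dilation. -/
theorem lintegral_sq_le_gagliardoSq_of_scale {s : ℝ} (h1 : 1 / 2 < s) (h2 : s < 1)
    {f : Eucl 2 → ℝ} (hf : Continuous f) {Z : Set (Eucl 2)} (hZ : ∀ z ∈ Z, f z = 0)
    (hcirc : ∀ p ∈ Z, ∀ ρ : ℝ, 0 < ρ → ∃ z ∈ Z, dist z p = ρ)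
    {R : ℝ} (hR : 0 < R) (hdense : ∀ x, ∃ p ∈ Z, dist p x ≤ R) :
    ∫⁻ x, ‖f x‖ₑ ^ 2 ≤
      ENNReal.ofReal (5443200 * ((1 - s) / (2 * s - 1)) * R ^ (2 * s)) * gagliardoSq s f := by
  have hd : ∀ x y : Eucl 2, dist (R • x) (R • y) = R * dist x y := fun x y => by
    rw [dist_smul₀, Real.norm_of_nonneg hR.le]
  have key := lintegral_sq_le_gagliardoSq h1 h2 (f := fun x => f (R • x)) (by fun_prop)
    (Z := {x | R • x ∈ Z}) (fun z hz => hZ _ hz)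
    (fun p hp ρ hρ => by
      obtain ⟨z, hz, hzp⟩ := hcirc _ hp (R * ρ) (by positivity)
      refine ⟨R⁻¹ • z, by simpa [smul_smul, hR.ne'] using hz, ?_⟩
      have := hd (R⁻¹ • z) p
      rw [smul_smul, mul_inv_cancel₀ hR.ne', one_smul, hzp] at this
      exact (mul_left_cancel₀ hR.ne' this).symm)
    (fun x => by
      obtain ⟨p, hp, hpx⟩ := hdense (R • x)
      refine ⟨R⁻¹ • p, by simpa [smul_smul, hR.ne'] using hp, ?_⟩
      have := hd (R⁻¹ • p) x
      rw [smul_smul, mul_inv_cancel₀ hR.ne', one_smul] at this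
      rw [this] at hpx
      nlinarith)
  have hc : 0 ≤ 5443200 * ((1 - s) / (2 * s - 1)) := by
    have : 0 < 2 * s - 1 := by linarith
    have : 0 < 1 - s := by linarith
    positivity
  rw [lintegral_eq_mul_lintegral_smul hR]
  refine (mul_le_mul_right key _).trans (le_of_eq ?_)
  rw [mul_left_comm, gagliardoSq_comp_smul s hR hf.measurable, ← mul_assoc,
    ← ENNReal.ofReal_mul hc]

/-! ### Lower bound for the fractional eigenvalue -/

theorem inradius_pos {Ω : Opens (Eucl 2)} (h : (Ω : Set (Eucl 2)).Nonempty) : 0 < inradius Ω := by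
  obtain ⟨x, hx⟩ := h
  obtain ⟨ρ, hρ, hball⟩ := Metric.isOpen_iff.1 Ω.isOpen x hx
  exact (ENNReal.ofReal_pos.2 hρ).trans_le (le_sSup ⟨ρ, hρ, ⟨x, hx, hball⟩, rfl⟩)

theorem exists_ball_subset_of_lt_inradius {Ω : Opens (Eucl 2)} {ρ : ℝ}
    (h : ENNReal.ofReal ρ < inradius Ω) :
    ∃ x, Metric.ball x ρ ⊆ (Ω : Set (Eucl 2)) := by
  obtain ⟨_, ⟨r, hr, ⟨x, _, hball⟩, rfl⟩, hlt⟩ := lt_sSup_iff.1 h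
  have : ρ < r := (ENNReal.ofReal_lt_ofReal_iff hr).1 hlt
  exact ⟨x, (Metric.ball_subset_ball this.le).trans hball⟩

theorem exists_notMem_of_inradius_lt {Ω : Opens (Eucl 2)} {R : ℝ} (hR : 0 < R)
    (h : inradius Ω < ENNReal.ofReal R) (x : Eucl 2) : ∃ p, p ∉ Ω ∧ dist p x ≤ R := by
  by_contra! hcon
  have hball : Metric.ball x R ⊆ (Ω : Set (Eucl 2)) := fun p hp => by
    by_contra hpΩ
    exact (hcon p hpΩ).not_gt (Metric.mem_ball.1 hp)
  exact h.not_ge (le_sSup ⟨R, hR, ⟨x, hball (Metric.mem_ball_self hR), hball⟩, rfl⟩)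

theorem eq_zero_of_notMem {Ω : Opens (Eucl 2)} (φ : 𝓓(Ω, ℝ)) {x : Eucl 2} (hx : x ∉ Ω) :
    φ x = 0 :=
  image_eq_zero_of_notMem_tsupport fun h => hx (φ.tsupport_subset h)

theorem gagliardo_sq (s : ℝ) (u : Eucl 2 → ℝ) : gagliardo s u ^ 2 = gagliardoSq s u :=
  rpow_half_sq _

/-- A quasi-triangle inequality for the squared seminorm. -/
theorem gagliardoSq_le_two_mul (s : ℝ) {u φ : Eucl 2 → ℝ} (hu : AEMeasurable u) :
    gagliardoSq s φ ≤ 2 * (gagliardoSq s u + gagliardoSq s fun x => u x - φ x) := by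
  let K : Eucl 2 → Eucl 2 → ℝ≥0∞ := fun x y => ‖x - y‖ₑ ^ (((2 : ℕ) : ℝ) + 2 * s)
  have hK : Measurable (Function.uncurry K) := by
    simp only [Function.uncurry_def, K]
    fun_prop
  have h1 : AEMeasurable (Function.uncurry fun x y => ‖u x - u y‖ₑ ^ 2 / K x y)
      ((volume : Measure (Eucl 2)).prod volume) :=
    (((hu.comp_quasiMeasurePreserving Measure.quasiMeasurePreserving_fst).sub
      (hu.comp_quasiMeasurePreserving Measure.quasiMeasurePreserving_snd)).enorm.pow_const 2).div
      hK.aemeasurable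
  have hin : ∀ x, AEMeasurable fun y => ‖u x - u y‖ₑ ^ 2 / K x y := fun x =>
    (((aemeasurable_const.sub hu).enorm.pow_const 2).div
      (hK.of_uncurry_left (x := x)).aemeasurable)
  have h2 : ∀ x y, ‖φ x - φ y‖ₑ ^ 2 / K x y ≤
      2 * (‖u x - u y‖ₑ ^ 2 / K x y + ‖(u x - φ x) - (u y - φ y)‖ₑ ^ 2 / K x y) := fun x y => by
    rw [← ENNReal.add_div, ← mul_div_assoc]
    gcongr
    refine le_trans ?_ (add_sq_le_two_mul _ _)
    gcongr
    refine le_trans (le_of_eq ?_) (enorm_sub_le)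
    congr 1
    ring
  calc gagliardoSq s φ ≤ ∫⁻ x, ∫⁻ y, 2 * (‖u x - u y‖ₑ ^ 2 / K x y +
        ‖(u x - φ x) - (u y - φ y)‖ₑ ^ 2 / K x y) :=
        lintegral_mono fun x => lintegral_mono fun y => h2 x y
    _ = _ := by
        simp_rw [lintegral_const_mul' _ _ ENNReal.ofNat_ne_top, lintegral_add_left' (hin _)]
        have h3 : AEMeasurable fun x => ∫⁻ y, ‖u x - u y‖ₑ ^ 2 / K x y := h1.lintegral_prod_right'
        rw [lintegral_add_left' h3]
        rfl

/-- A Poincaré inequality for test functions extends to their closure in `W^{s,2}`, up to a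
factor `2`. -/
theorem lintegral_sq_le_of_memWs20 {s : ℝ} {Ω : Opens (Eucl 2)} {K : ℝ≥0∞} (hK : K ≠ ∞)
    (h : ∀ φ : 𝓓(Ω, ℝ), ∫⁻ x, ‖φ x‖ₑ ^ 2 ≤ K * gagliardoSq s φ) {u : Eucl 2 → ℝ}
    (hu : MemWs20 s Ω u) : ∫⁻ x, ‖u x‖ₑ ^ 2 ≤ 2 * K * gagliardoSq s u := by
  have hε : ∀ ε : ℝ≥0∞, 0 < ε → eLpNorm u 2 volume ≤
      ε + (K * (2 * (gagliardoSq s u + ε ^ 2))) ^ (1 / 2 : ℝ) := by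
    intro ε hε
    obtain ⟨φ, hφ⟩ := hu.approx ε hε
    have h1 : eLpNorm (fun x => u x - φ x) 2 volume ≤ ε := le_self_add.trans hφ.le
    have h2 : gagliardo s (fun x => u x - φ x) ≤ ε := le_add_self.trans hφ.le
    have h3 : eLpNorm φ 2 volume ≤ (K * (2 * (gagliardoSq s u + ε ^ 2))) ^ (1 / 2 : ℝ) := by
      rw [← sq_rpow_half (eLpNorm φ 2 volume), eLpNorm_two_sq]
      refine ENNReal.rpow_le_rpow ?_ (by norm_num)
      refine (h φ).trans (mul_le_mul_right ?_ _)
      refine (gagliardoSq_le_two_mul s hu.memLp.aestronglyMeasurable.aemeasurable).trans ?_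
      rw [← gagliardo_sq s fun x => u x - φ x]
      gcongr
    have h4 : u = (fun x => u x - φ x) + (φ : Eucl 2 → ℝ) := by ext x; simp
    calc eLpNorm u 2 volume = eLpNorm ((fun x => u x - φ x) + (φ : Eucl 2 → ℝ)) 2 volume := by
          rw [← h4]
      _ ≤ _ := (eLpNorm_add_le (hu.memLp.aestronglyMeasurable.sub
          φ.continuous.aestronglyMeasurable) φ.continuous.aestronglyMeasurable (by norm_num)).trans
          (add_le_add h1 h3)
  have hcont : Continuous fun ε : ℝ≥0∞ =>
      ε + (K * (2 * (gagliardoSq s u + ε ^ 2))) ^ (1 / 2 : ℝ) := by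
    refine continuous_id.add (ENNReal.continuous_rpow_const.comp ?_)
    refine (ENNReal.continuous_const_mul hK).comp ?_
    refine (ENNReal.continuous_const_mul ENNReal.ofNat_ne_top).comp ?_
    exact continuous_const.add (ENNReal.continuous_pow 2)
  have hlim := (hcont.tendsto 0).comp ENNReal.tendsto_inv_nat_nhds_zero
  have hle := ge_of_tendsto' hlim fun n => hε _ (ENNReal.inv_pos.2 (ENNReal.natCast_ne_top n))
  simp only [zero_add, ne_eq, OfNat.ofNat_ne_zero, not_false_eq_true, zero_pow, add_zero] at hle
  calc ∫⁻ x, ‖u x‖ₑ ^ 2 = eLpNorm u 2 volume ^ 2 := (eLpNorm_two_sq _ _).symm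
    _ ≤ ((K * (2 * gagliardoSq s u)) ^ (1 / 2 : ℝ)) ^ 2 := by gcongr
    _ = _ := by rw [rpow_half_sq]; ring

theorem inv_le_lambdaFrac {s : ℝ} {Ω : Opens (Eucl 2)} {K : ℝ≥0∞} (hK0 : K ≠ 0) (hK : K ≠ ∞)
    (h : ∀ φ : 𝓓(Ω, ℝ), ∫⁻ x, ‖φ x‖ₑ ^ 2 ≤ K * gagliardoSq s φ) :
    (2 * K)⁻¹ ≤ lambdaFrac s Ω := by
  refine le_iInf fun u => le_iInf fun hu => le_iInf fun hu0 => ?_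
  have hle := lintegral_sq_le_of_memWs20 hK h hu
  have hne : ∫⁻ x, ‖u x‖ₑ ^ 2 ≠ 0 := by
    intro h0
    rw [← eLpNorm_two_sq, pow_eq_zero_iff two_ne_zero,
      eLpNorm_eq_zero_iff hu.memLp.aestronglyMeasurable two_ne_zero] at h0
    exact hu0 h0
  have hg : gagliardoSq s u ≠ 0 := by
    intro h0
    rw [h0, mul_zero] at hle
    exact hne (le_antisymm hle zero_le)
  have h2K : 2 * K ≠ 0 := by simp [hK0]
  have h2K' : 2 * K ≠ ∞ := ENNReal.mul_ne_top ENNReal.ofNat_ne_top hK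
  rw [gagliardo_sq, ENNReal.le_div_iff_mul_le (Or.inr hg) (Or.inr (by
    rw [← gagliardo_sq]; exact ENNReal.pow_ne_top hu.gagliardo_lt_top.ne)),
    ENNReal.inv_mul_le_iff h2K h2K']
  exact (setLIntegral_le_lintegral _ _).trans hle

/-- Lower bound for the fractional eigenvalue of a simply connected set at a scale `R` larger than
the inradius. -/
theorem inv_le_lambdaFrac_of_isSimplyConnected {s : ℝ} (h1 : 1 / 2 < s) (h2 : s < 1)
    {Ω : Opens (Eucl 2)} (hΩ : IsSimplyConnected (Ω : Set (Eucl 2))) {R : ℝ} (hR : 0 < R)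
    (hin : inradius Ω < ENNReal.ofReal R) :
    (2 * ENNReal.ofReal (5443200 * ((1 - s) / (2 * s - 1)) * R ^ (2 * s)))⁻¹ ≤
      lambdaFrac s Ω := by
  refine inv_le_lambdaFrac ?_ ENNReal.ofReal_ne_top fun φ => ?_
  · have : 0 < 2 * s - 1 := by linarith
    have : 0 < 1 - s := by linarith
    simp only [ne_eq, ENNReal.ofReal_eq_zero, not_le]
    positivity
  · refine lintegral_sq_le_gagliardoSq_of_scale h1 h2 φ.continuous
      (Z := {x | x ∉ Ω}) (fun z hz => eq_zero_of_notMem φ hz) ?_ hR ?_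
    · exact fun p hp ρ hρ => exists_notMem_dist_eq hΩ Ω.isOpen hp hρ
    · exact exists_notMem_of_inradius_lt hR hin

/-! ### Test functions and the upper bound for the first Dirichlet eigenvalue -/

theorem norm_gradient_eq (f : Eucl 2 → ℝ) (x : Eucl 2) : ‖gradient f x‖ = ‖fderiv ℝ f x‖ := by
  rw [gradient, LinearIsometryEquiv.norm_map]

theorem enorm_gradient_eq (f : Eucl 2 → ℝ) (x : Eucl 2) : ‖gradient f x‖ₑ = ‖fderiv ℝ f x‖ₑ := by
  rw [← ofReal_norm, ← ofReal_norm, norm_gradient_eq]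

theorem continuous_gradient {Ω : Opens (Eucl 2)} (φ : 𝓓(Ω, ℝ)) : Continuous (gradient φ) := by
  have h : Continuous (fderiv ℝ φ) := φ.contDiff.continuous_fderiv (by simp)
  exact (LinearIsometryEquiv.continuous _).comp h

theorem hasCompactSupport_gradient {Ω : Opens (Eucl 2)} (φ : 𝓓(Ω, ℝ)) :
    HasCompactSupport (gradient φ) :=
  (φ.hasCompactSupport.fderiv (𝕜 := ℝ)).comp_left (map_zero _)

theorem memLp_testFunction {Ω : Opens (Eucl 2)} (φ : 𝓓(Ω, ℝ)) : MemLp φ 2 volume :=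
  φ.continuous.memLp_of_hasCompactSupport φ.hasCompactSupport

theorem memLp_gradient {Ω : Opens (Eucl 2)} (φ : 𝓓(Ω, ℝ)) : MemLp (gradient φ) 2 volume :=
  (continuous_gradient φ).memLp_of_hasCompactSupport (hasCompactSupport_gradient φ)

theorem hasWeakGradient_gradient {Ω : Opens (Eucl 2)} (φ : 𝓓(Ω, ℝ)) :
    HasWeakGradient Ω φ (gradient φ) := by
  intro ψ v
  have hd : ∀ θ : 𝓓(Ω, ℝ), Continuous fun x => fderiv ℝ θ x v := fun θ =>
    (θ.contDiff.continuous_fderiv (by simp)).clm_apply continuous_const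
  rw [setIntegral_eq_integral_of_forall_compl_eq_zero fun x hx => by
      rw [eq_zero_of_notMem φ hx, zero_mul],
    setIntegral_eq_integral_of_forall_compl_eq_zero fun x hx => by
      rw [eq_zero_of_notMem ψ hx, mul_zero]]
  simp_rw [inner_gradient_left]
  refine integral_mul_fderiv_eq_neg_fderiv_mul_of_integrable ?_ ?_ ?_ ?_ ?_
  · exact ((hd φ).mul ψ.continuous).integrable_of_hasCompactSupport ψ.hasCompactSupport.mul_left
  · exact (φ.continuous.mul (hd ψ)).integrable_of_hasCompactSupport φ.hasCompactSupport.mul_right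
  · exact (φ.continuous.mul ψ.continuous).integrable_of_hasCompactSupport
      φ.hasCompactSupport.mul_right
  · exact fun x _ => (φ.contDiff.differentiable (by simp)) x
  · exact fun x _ => (ψ.contDiff.differentiable (by simp)) x

theorem memW120_testFunction {Ω : Opens (Eucl 2)} (φ : 𝓓(Ω, ℝ)) :
    MemW120 Ω φ (gradient φ) where
  memLp := (memLp_testFunction φ).restrict _
  memLp_grad := (memLp_gradient φ).restrict _
  weakGrad := hasWeakGradient_gradient φ
  approx ε hε := ⟨φ, by simpa using hε⟩

theorem lintegral_testFunction_eq {Ω : Opens (Eucl 2)} (φ : 𝓓(Ω, ℝ)) :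
    ∫⁻ x in (Ω : Set (Eucl 2)), ‖φ x‖ₑ ^ 2 = ∫⁻ x, ‖φ x‖ₑ ^ 2 := by
  rw [← lintegral_indicator Ω.isOpen.measurableSet]
  refine lintegral_congr fun x => ?_
  by_cases hx : x ∈ Ω
  · rw [Set.indicator_of_mem (by exact hx)]
  · rw [Set.indicator_of_notMem (by exact hx), eq_zero_of_notMem φ hx]
    simp

theorem lambdaOne_le_testFunction {Ω : Opens (Eucl 2)} (φ : 𝓓(Ω, ℝ))
    (hφ : ∫⁻ x, ‖φ x‖ₑ ^ 2 ≠ 0) :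
    lambdaOne Ω ≤ (∫⁻ x, ‖fderiv ℝ φ x‖ₑ ^ 2) / ∫⁻ x, ‖φ x‖ₑ ^ 2 := by
  have hne : ¬ (φ : Eucl 2 → ℝ) =ᵐ[volume.restrict Ω] 0 := by
    intro h
    rw [← lintegral_testFunction_eq, ← eLpNorm_two_sq, eLpNorm_congr_ae h] at hφ
    simp at hφ
  refine iInf_le_of_le φ (iInf_le_of_le (gradient φ) (iInf₂_le_of_le
    (memW120_testFunction φ) hne ?_))
  rw [lintegral_testFunction_eq]
  refine ENNReal.div_le_div_right ((setLIntegral_le_lintegral _ _).trans_eq ?_) _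
  exact lintegral_congr fun x => by rw [enorm_gradient_eq]

/-- The first Dirichlet eigenvalue of a set containing a ball of radius `ρ` is `O(ρ⁻²)`, by testing
with rescaled copies of a fixed bump function. -/
theorem exists_lambdaOne_le :
    ∃ C : ℝ, 0 < C ∧ ∀ (Ω : Opens (Eucl 2)) (x₀ : Eucl 2) (ρ : ℝ), 0 < ρ →
      Metric.ball x₀ ρ ⊆ (Ω : Set (Eucl 2)) → lambdaOne Ω ≤ ENNReal.ofReal (C / ρ ^ 2) := by
  let ψ : ContDiffBump (0 : Eucl 2) := ⟨1 / 4, 1 / 2, by norm_num, by norm_num⟩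
  have hψc : Continuous ψ := ψ.continuous
  have hψm : MemLp ψ 2 volume := hψc.memLp_of_hasCompactSupport ψ.hasCompactSupport
  have hψd : ContDiff ℝ ((⊤ : ℕ∞) : WithTop ℕ∞) ψ := ψ.contDiff
  have hψD : Differentiable ℝ ψ := hψd.differentiable (by simp)
  have hψm' : MemLp (fderiv ℝ ψ) 2 volume :=
    (hψd.continuous_fderiv (by simp)).memLp_of_hasCompactSupport
      (ψ.hasCompactSupport.fderiv (𝕜 := ℝ))
  set F := ∫⁻ x, ‖ψ x‖ₑ ^ 2 with hF
  set G := ∫⁻ x, ‖fderiv ℝ ψ x‖ₑ ^ 2 with hG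
  have hFtop : F ≠ ∞ := by
    rw [hF, ← eLpNorm_two_sq]
    exact ENNReal.pow_ne_top hψm.eLpNorm_ne_top
  have hGtop : G ≠ ∞ := by
    rw [hG, ← eLpNorm_two_sq]
    exact ENNReal.pow_ne_top hψm'.eLpNorm_ne_top
  have hF0 : F ≠ 0 := by
    rw [hF, ← eLpNorm_two_sq]
    intro h
    rw [pow_eq_zero_iff two_ne_zero, eLpNorm_eq_zero_iff hψc.aestronglyMeasurable two_ne_zero] at h
    have h2 := (hψc.ae_eq_iff_eq volume continuous_zero).1 h
    have h3 : ψ 0 = 1 := ψ.one_of_mem_closedBall (Metric.mem_closedBall_self ψ.rIn_pos.le)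
    rw [h2] at h3
    simp at h3
  have hGF : G / F ≠ ∞ := ENNReal.div_ne_top hGtop hF0
  refine ⟨(G / F).toReal + 1, by positivity, fun Ω x₀ ρ hρ hball => ?_⟩
  let f : Eucl 2 → ℝ := fun x => ψ (ρ⁻¹ • (x - x₀))
  have hfsupp : ∀ x, x ∉ Metric.closedBall x₀ (ρ / 2) → f x = 0 := by
    intro x hx
    refine ψ.zero_of_le_dist ?_
    rw [Metric.mem_closedBall, not_le, dist_eq_norm] at hx
    rw [dist_zero_right, norm_smul, norm_inv, Real.norm_of_nonneg hρ.le, inv_mul_eq_div,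
      le_div_iff₀ hρ]
    show 1 / 2 * ρ ≤ _
    linarith
  have hts : tsupport f ⊆ Metric.closedBall x₀ (ρ / 2) :=
    closure_minimal (fun x hx => by_contra fun h => hx (hfsupp x h)) Metric.isClosed_closedBall
  let φ : 𝓓(Ω, ℝ) :=
    { toFun := f
      contDiff' := hψd.comp (by fun_prop)
      hasCompactSupport' := HasCompactSupport.intro (isCompact_closedBall x₀ (ρ / 2)) hfsupp
      tsupport_subset' := hts.trans ((Metric.closedBall_subset_ball (by linarith)).trans hball) }
  have hφ : ∀ x, φ x = ψ (ρ⁻¹ • (x - x₀)) := fun x => rfl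
  have hscale : ∀ g : Eucl 2 → ℝ≥0∞,
      ∫⁻ x, g (ρ⁻¹ • (x - x₀)) = ENNReal.ofReal (ρ ^ 2) * ∫⁻ x, g x := by
    intro g
    rw [lintegral_sub_right_eq_self (fun x => g (ρ⁻¹ • x)) x₀, lintegral_eq_mul_lintegral_smul hρ]
    simp [smul_smul, inv_mul_cancel₀ hρ.ne']
  have hfd : ∀ x, fderiv ℝ φ x = ρ⁻¹ • fderiv ℝ ψ (ρ⁻¹ • (x - x₀)) := by
    intro x
    have h1 : HasFDerivAt (fun x : Eucl 2 => ρ⁻¹ • (x - x₀))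
        (ρ⁻¹ • ContinuousLinearMap.id ℝ (Eucl 2)) x :=
      ((hasFDerivAt_id x).sub_const x₀).const_smul ρ⁻¹
    have h2 := (hψD (ρ⁻¹ • (x - x₀))).hasFDerivAt.comp x h1
    have h3 := h2.fderiv
    rw [ContinuousLinearMap.comp_smul, ContinuousLinearMap.comp_id] at h3
    exact h3
  have hφF : ∫⁻ x, ‖φ x‖ₑ ^ 2 = ENNReal.ofReal (ρ ^ 2) * F := by
    simp_rw [hφ]
    exact hscale fun x => ‖ψ x‖ₑ ^ 2
  have hφG : ∫⁻ x, ‖fderiv ℝ φ x‖ₑ ^ 2 = G := by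
    simp_rw [hfd, enorm_smul, mul_pow]
    rw [lintegral_const_mul' _ _ (by simp), hscale fun x => ‖fderiv ℝ ψ x‖ₑ ^ 2, ← mul_assoc,
      Real.enorm_eq_ofReal (by positivity), ← ENNReal.ofReal_pow (by positivity),
      ← ENNReal.ofReal_mul (by positivity), ← mul_pow, inv_mul_cancel₀ hρ.ne',
      one_pow, ENNReal.ofReal_one, one_mul]
  have hρ0 : ENNReal.ofReal (ρ ^ 2) ≠ 0 := by simp; positivity
  refine (lambdaOne_le_testFunction φ (by rw [hφF]; exact mul_ne_zero hρ0 hF0)).trans ?_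
  rw [hφF, hφG, ENNReal.ofReal_div_of_pos (by positivity)]
  calc G / (ENNReal.ofReal (ρ ^ 2) * F) = G / F / ENNReal.ofReal (ρ ^ 2) := by
        rw [div_eq_mul_inv, ENNReal.mul_inv (Or.inl hρ0) (Or.inl ENNReal.ofReal_ne_top),
          div_eq_mul_inv, div_eq_mul_inv]
        ring
    _ ≤ _ := by
        gcongr
        refine (ENNReal.ofReal_toReal hGF).symm.le.trans (ENNReal.ofReal_le_ofReal ?_)
        linarith

/-! ### Interpolation between `L²` and the Dirichlet energy -/

/-- Translation differences are controlled by the Dirichlet energy, by integrating the derivative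
along the segment from `x` to `x + h`. -/
theorem diffSq_le_lintegral_fderiv {f : Eucl 2 → ℝ} (hf : ContDiff ℝ 1 f) (h : Eucl 2) :
    diffSq f h ≤ ‖h‖ₑ ^ 2 * ∫⁻ x, ‖fderiv ℝ f x‖ₑ ^ 2 := by
  have hfc : Continuous (fderiv ℝ f) := hf.continuous_fderiv (by simp)
  have hfd : Differentiable ℝ f := hf.differentiable (by simp)
  have : IsProbabilityMeasure (volume.restrict (Set.Ioc (0 : ℝ) 1)) := ⟨by simp⟩
  have hpt : ∀ x, ‖f (x + h) - f x‖ₑ ^ 2 ≤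
      ∫⁻ t in Set.Ioc (0 : ℝ) 1, ‖h‖ₑ ^ 2 * ‖fderiv ℝ f (x + t • h)‖ₑ ^ 2 := by
    intro x
    let g : ℝ → ℝ := fun t => fderiv ℝ f (x + t • h) h
    have hg : Continuous g := by fun_prop
    have hder : ∀ t : ℝ, HasDerivAt (fun t : ℝ => f (x + t • h)) (g t) t := fun t => by
      have h1 : HasDerivAt (fun t : ℝ => x + t • h) h t := by
        simpa using ((hasDerivAt_id t).smul_const h).const_add x
      exact (hfd (x + t • h)).hasFDerivAt.comp_hasDerivAt t h1
    have hint : f (x + h) - f x = ∫ t in Set.Ioc (0 : ℝ) 1, g t := by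
      rw [← intervalIntegral.integral_of_le zero_le_one,
        intervalIntegral.integral_eq_sub_of_hasDerivAt (fun t _ => hder t)
          (hg.intervalIntegrable _ _)]
      simp
    calc ‖f (x + h) - f x‖ₑ ^ 2
        ≤ (eLpNorm g 1 (volume.restrict (Set.Ioc (0 : ℝ) 1))) ^ 2 := by
          rw [hint, eLpNorm_one_eq_lintegral_enorm]
          gcongr
          exact enorm_integral_le_lintegral_enorm _
      _ ≤ (eLpNorm g 2 (volume.restrict (Set.Ioc (0 : ℝ) 1))) ^ 2 := by
          gcongr
          exact eLpNorm_le_eLpNorm_of_exponent_le (by norm_num) hg.aestronglyMeasurable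
      _ ≤ _ := by
          rw [eLpNorm_two_sq]
          refine lintegral_mono fun t => ?_
          rw [← mul_pow, mul_comm]
          gcongr
          exact ContinuousLinearMap.le_opENorm _ _
  have hm : Measurable (Function.uncurry fun (x : Eucl 2) (t : ℝ) =>
      ‖h‖ₑ ^ 2 * ‖fderiv ℝ f (x + t • h)‖ₑ ^ 2) := by
    have h1 : Continuous fun q : Eucl 2 × ℝ => fderiv ℝ f (q.1 + q.2 • h) := by fun_prop
    exact (h1.measurable.enorm.pow_const 2).const_mul _
  calc diffSq f h ≤ ∫⁻ x, ∫⁻ t in Set.Ioc (0 : ℝ) 1,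
        ‖h‖ₑ ^ 2 * ‖fderiv ℝ f (x + t • h)‖ₑ ^ 2 := lintegral_mono hpt
    _ = ∫⁻ t in Set.Ioc (0 : ℝ) 1, ∫⁻ x, ‖h‖ₑ ^ 2 * ‖fderiv ℝ f (x + t • h)‖ₑ ^ 2 :=
        lintegral_lintegral_swap hm.aemeasurable
    _ = ∫⁻ t in Set.Ioc (0 : ℝ) 1, ‖h‖ₑ ^ 2 * ∫⁻ x, ‖fderiv ℝ f x‖ₑ ^ 2 := by
        refine lintegral_congr fun t => ?_
        rw [lintegral_add_right_eq_self (fun x => ‖h‖ₑ ^ 2 * ‖fderiv ℝ f x‖ₑ ^ 2),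
          lintegral_const_mul' _ _ (by simp)]
    _ = _ := by simp

theorem diffSq_le_four_mul {f : Eucl 2 → ℝ} (hf : Measurable f) (h : Eucl 2) :
    diffSq f h ≤ 4 * ∫⁻ x, ‖f x‖ₑ ^ 2 := by
  calc diffSq f h ≤ ∫⁻ x, 2 * (‖f (x + h)‖ₑ ^ 2 + ‖f x‖ₑ ^ 2) :=
        lintegral_mono fun x => le_trans (by gcongr; exact enorm_sub_le) (add_sq_le_two_mul _ _)
    _ = 2 * ((∫⁻ x, ‖f x‖ₑ ^ 2) + ∫⁻ x, ‖f x‖ₑ ^ 2) := by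
        rw [lintegral_const_mul _ (by fun_prop), lintegral_add_right _ (by fun_prop),
          lintegral_add_right_eq_self (fun x => ‖f x‖ₑ ^ 2)]
    _ = _ := by ring

/-- Integration of a radial function in polar coordinates. -/
theorem lintegral_fun_norm_eq {g : ℝ → ℝ} (hg0 : ∀ t, 0 ≤ g t)
    (hg : IntegrableOn (fun y => y * g y) (Set.Ioi 0)) :
    ∫⁻ h : Eucl 2, ENNReal.ofReal (g ‖h‖) =
      ENNReal.ofReal (2 * Real.pi * ∫ y in Set.Ioi (0 : ℝ), y * g y) := by
  have hint : Integrable (fun h : Eucl 2 => g ‖h‖) := by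
    rw [integrable_fun_norm_addHaar]
    simpa using hg
  rw [← ofReal_integral_eq_lintegral_ofReal hint (Eventually.of_forall fun h => hg0 _),
    integral_fun_norm_addHaar]
  congr 1
  simp [Measure.real, Real.pi_pos.le]
  ring

theorem lintegral_ball_sq_div_le {s : ℝ} (h1 : s < 1) {R : ℝ} (hR : 0 < R) :
    ∫⁻ h in Metric.ball (0 : Eucl 2) R, ‖h‖ₑ ^ 2 / ‖h‖ₑ ^ (2 + 2 * s) ≤
      ENNReal.ofReal (Real.pi / (1 - s) * R ^ (2 - 2 * s)) := by
  let g : ℝ → ℝ := (Set.Ioo 0 R).indicator fun t => t ^ (-(2 * s))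
  have hg0 : ∀ t, 0 ≤ g t := fun t => Set.indicator_nonneg (fun t ht => by
    have := ht.1; positivity) t
  have hyg : (fun y => y * g y) = (Set.Ioo 0 R).indicator fun t => t ^ (1 - 2 * s) := by
    ext y
    by_cases hy : y ∈ Set.Ioo 0 R
    · simp only [g, Set.indicator_of_mem hy]
      rw [sub_eq_add_neg, Real.rpow_add hy.1, Real.rpow_one]
    · simp only [g, Set.indicator_of_notMem hy, mul_zero]
  have hsub : Set.Ioi (0 : ℝ) ∩ Set.Ioo 0 R = Set.Ioo 0 R :=
    Set.inter_eq_right.2 fun y hy => hy.1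
  have hint : IntegrableOn (fun y => y * g y) (Set.Ioi 0) := by
    rw [hyg]
    refine IntegrableOn.integrable_indicator ?_ measurableSet_Ioo |>.integrableOn
    have := intervalIntegral.intervalIntegrable_rpow' (a := 0) (b := R) (r := 1 - 2 * s)
      (by linarith)
    exact (intervalIntegrable_iff_integrableOn_Ioo_of_le hR.le).1 this
  calc ∫⁻ h in Metric.ball (0 : Eucl 2) R, ‖h‖ₑ ^ 2 / ‖h‖ₑ ^ (2 + 2 * s)
      ≤ ∫⁻ h : Eucl 2, ENNReal.ofReal (g ‖h‖) := by
        rw [← lintegral_indicator measurableSet_ball]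
        refine lintegral_mono fun h => ?_
        by_cases hh : h ∈ Metric.ball (0 : Eucl 2) R
        · rw [Set.indicator_of_mem hh]
          rcases eq_or_ne h 0 with rfl | hne
          · simp
          have hn : 0 < ‖h‖ := norm_pos_iff.2 hne
          have : ‖h‖ ∈ Set.Ioo 0 R := ⟨hn, mem_ball_zero_iff.1 hh⟩
          simp only [g, Set.indicator_of_mem this]
          rw [← ofReal_norm, ENNReal.ofReal_rpow_of_pos hn, ← ENNReal.ofReal_pow hn.le,
            ← ENNReal.ofReal_div_of_pos (by positivity), ← Real.rpow_natCast, ← Real.rpow_sub hn]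
          refine le_of_eq ?_
          congr 2
          push_cast
          ring
        · simp [Set.indicator_of_notMem hh]
    _ = _ := by
        rw [lintegral_fun_norm_eq hg0 hint, hyg, setIntegral_indicator measurableSet_Ioo, hsub,
          ← integral_Ioc_eq_integral_Ioo, ← intervalIntegral.integral_of_le hR.le,
          integral_rpow (Or.inl (by linarith)), Real.zero_rpow (by linarith)]
        congr 1
        have : 1 - s ≠ 0 := by linarith
        rw [show 1 - 2 * s + 1 = 2 - 2 * s by ring, show 2 - 2 * s = 2 * (1 - s) by ring]
        field_simp
        ring

theorem lintegral_compl_ball_inv_le {s : ℝ} (h0 : 0 < s) {R : ℝ} (hR : 0 < R) :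
    ∫⁻ h in (Metric.ball (0 : Eucl 2) R)ᶜ, (‖h‖ₑ ^ (2 + 2 * s))⁻¹ ≤
      ENNReal.ofReal (Real.pi / s * R ^ (-(2 * s))) := by
  let g : ℝ → ℝ := (Set.Ici R).indicator fun t => t ^ (-(2 + 2 * s))
  have hg0 : ∀ t, 0 ≤ g t := fun t => Set.indicator_nonneg (fun t ht => by
    have : 0 < t := hR.trans_le ht
    positivity) t
  have hyg : (fun y => y * g y) = (Set.Ici R).indicator fun t => t ^ (-1 - 2 * s) := by
    ext y
    by_cases hy : y ∈ Set.Ici R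
    · simp only [g, Set.indicator_of_mem hy]
      have h : 0 < y := hR.trans_le hy
      rw [show -1 - 2 * s = 1 + -(2 + 2 * s) by ring, Real.rpow_add h, Real.rpow_one]
    · simp only [g, Set.indicator_of_notMem hy, mul_zero]
  have hsub : Set.Ioi (0 : ℝ) ∩ Set.Ici R = Set.Ici R :=
    Set.inter_eq_right.2 fun y hy => hR.trans_le hy
  have hint : IntegrableOn (fun y => y * g y) (Set.Ioi 0) := by
    rw [hyg]
    refine IntegrableOn.integrable_indicator ?_ measurableSet_Ici |>.integrableOn
    rw [integrableOn_Ici_iff_integrableOn_Ioi]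
    exact integrableOn_Ioi_rpow_of_lt (by linarith) hR
  calc ∫⁻ h in (Metric.ball (0 : Eucl 2) R)ᶜ, (‖h‖ₑ ^ (2 + 2 * s))⁻¹
      ≤ ∫⁻ h : Eucl 2, ENNReal.ofReal (g ‖h‖) := by
        rw [← lintegral_indicator measurableSet_ball.compl]
        refine lintegral_mono fun h => ?_
        by_cases hh : h ∈ (Metric.ball (0 : Eucl 2) R)ᶜ
        · rw [Set.indicator_of_mem hh]
          have hRh : R ≤ ‖h‖ := by simpa using hh
          have hn : 0 < ‖h‖ := hR.trans_le hRh
          simp only [g, Set.indicator_of_mem (Set.mem_Ici.2 hRh)]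
          rw [← ofReal_norm, ENNReal.ofReal_rpow_of_pos hn,
            ← ENNReal.ofReal_inv_of_pos (by positivity), Real.rpow_neg hn.le]
        · simp [Set.indicator_of_notMem hh]
    _ = _ := by
        rw [lintegral_fun_norm_eq hg0 hint, hyg, setIntegral_indicator measurableSet_Ici, hsub,
          integral_Ici_eq_integral_Ioi, integral_Ioi_rpow_of_lt (by linarith) hR]
        congr 1
        rw [show -1 - 2 * s + 1 = -(2 * s) by ring]
        field_simp

/-- Interpolation between `L²` and the Dirichlet energy: the differences are split at the length
`R = ‖f‖ / ‖∇f‖`. -/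
theorem gagliardoSq_le_interpolation {s : ℝ} (h1 : 1 / 2 < s) (h2 : s < 1) {f : Eucl 2 → ℝ}
    (hf : ContDiff ℝ 1 f) (hF : ∫⁻ x, ‖f x‖ₑ ^ 2 ≠ ∞) (hG : ∫⁻ x, ‖fderiv ℝ f x‖ₑ ^ 2 ≠ ∞) :
    gagliardoSq s f ≤ ENNReal.ofReal (16 / (1 - s)) *
      ((∫⁻ x, ‖f x‖ₑ ^ 2) ^ (1 - s) * (∫⁻ x, ‖fderiv ℝ f x‖ₑ ^ 2) ^ s) := by
  set F := ∫⁻ x, ‖f x‖ₑ ^ 2 with hFdef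
  set G := ∫⁻ x, ‖fderiv ℝ f x‖ₑ ^ 2 with hGdef
  have hfm : Measurable f := hf.continuous.measurable
  have hDG : ∀ h, diffSq f h ≤ ‖h‖ₑ ^ 2 * G := diffSq_le_lintegral_fderiv hf
  have hDF : ∀ h, diffSq f h ≤ 4 * F := diffSq_le_four_mul hfm
  rw [gagliardoSq_eq_lintegral_diffSq s hfm]
  rcases eq_or_ne F 0 with hF0 | hF0
  · have : ∀ h, diffSq f h = 0 := fun h => le_antisymm (by simpa [hF0] using hDF h) zero_le
    simp [this]
  rcases eq_or_ne G 0 with hG0 | hG0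
  · have : ∀ h, diffSq f h = 0 := fun h => le_antisymm (by simpa [hG0] using hDG h) zero_le
    simp [this]
  have ha : 0 < F.toReal := ENNReal.toReal_pos hF0 hF
  have hb : 0 < G.toReal := ENNReal.toReal_pos hG0 hG
  set a := F.toReal with hadef
  set b := G.toReal with hbdef
  have hFa : F = ENNReal.ofReal a := (ENNReal.ofReal_toReal hF).symm
  have hGb : G = ENNReal.ofReal b := (ENNReal.ofReal_toReal hG).symm
  set R := (a / b) ^ (1 / 2 : ℝ) with hRdef
  have hR : 0 < R := by positivity
  have hRpow : ∀ t : ℝ, R ^ (2 * t) = (a / b) ^ t := fun t => by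
    rw [hRdef, ← Real.rpow_mul (by positivity)]
    congr 1
    ring
  have hs : 0 < 1 - s := by linarith
  rw [← lintegral_add_compl _ (measurableSet_ball (x := (0 : Eucl 2)) (ε := R))]
  have hnear : ∫⁻ h in Metric.ball 0 R, diffSq f h / ‖h‖ₑ ^ (2 + 2 * s) ≤
      ENNReal.ofReal (Real.pi / (1 - s) * (a ^ (1 - s) * b ^ s)) := by
    calc _ ≤ ∫⁻ h in Metric.ball (0 : Eucl 2) R, G * (‖h‖ₑ ^ 2 / ‖h‖ₑ ^ (2 + 2 * s)) := by
          refine lintegral_mono fun h => ?_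
          rw [← mul_div_assoc, mul_comm G]
          gcongr
          exact hDG h
      _ ≤ ENNReal.ofReal b * ENNReal.ofReal (Real.pi / (1 - s) * R ^ (2 - 2 * s)) := by
          rw [lintegral_const_mul' _ _ hG, ← hGb]
          gcongr
          exact lintegral_ball_sq_div_le h2 hR
      _ = _ := by
          rw [← ENNReal.ofReal_mul hb.le, show 2 - 2 * s = 2 * (1 - s) by ring, hRpow,
            Real.div_rpow ha.le hb.le]
          congr 1
          have : b = b ^ (1 - s) * b ^ s := by
            rw [← Real.rpow_add hb]; simp
          have hb' : 0 < b ^ (1 - s) := by positivity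
          field_simp
          exact this
  have hfar : ∫⁻ h in (Metric.ball 0 R)ᶜ, diffSq f h / ‖h‖ₑ ^ (2 + 2 * s) ≤
      ENNReal.ofReal (4 * Real.pi / s * (a ^ (1 - s) * b ^ s)) := by
    calc _ ≤ ∫⁻ h in (Metric.ball (0 : Eucl 2) R)ᶜ, 4 * F * (‖h‖ₑ ^ (2 + 2 * s))⁻¹ := by
          refine lintegral_mono fun h => ?_
          rw [div_eq_mul_inv]
          gcongr
          exact hDF h
      _ ≤ ENNReal.ofReal (4 * a) * ENNReal.ofReal (Real.pi / s * R ^ (-(2 * s))) := by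
          rw [lintegral_const_mul' _ _ (ENNReal.mul_ne_top (by simp) hF), hFa,
            ENNReal.ofReal_mul (by norm_num), ENNReal.ofReal_ofNat]
          gcongr
          exact lintegral_compl_ball_inv_le (by linarith) hR
      _ = _ := by
          rw [← ENNReal.ofReal_mul (by positivity), show -(2 * s) = 2 * (-s) by ring, hRpow,
            Real.rpow_neg (by positivity), Real.div_rpow ha.le hb.le, Real.rpow_sub ha,
            Real.rpow_one]
          congr 1
          have ha' : 0 < a ^ s := by positivity
          have hb' : 0 < b ^ s := by positivity
          field_simp
  refine (add_le_add hnear hfar).trans ?_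
  rw [hFa, hGb, ENNReal.ofReal_rpow_of_pos ha, ENNReal.ofReal_rpow_of_pos hb,
    ← ENNReal.ofReal_mul (by positivity), ← ENNReal.ofReal_mul (by positivity),
    ← ENNReal.ofReal_add (by positivity) (by positivity), ← add_mul]
  gcongr
  rw [div_add_div _ _ hs.ne' (by linarith), div_le_div_iff₀ (by nlinarith) hs]
  have := Real.pi_lt_d2
  nlinarith [mul_pos hs hs, mul_pos hs (show 0 < s by linarith), Real.pi_pos]

/-! ### Comparison of the eigenvalues -/

theorem lintegral_gradient_testFunction_eq {Ω : Opens (Eucl 2)} (φ : 𝓓(Ω, ℝ)) :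
    ∫⁻ x in (Ω : Set (Eucl 2)), ‖gradient φ x‖ₑ ^ 2 = ∫⁻ x, ‖fderiv ℝ φ x‖ₑ ^ 2 := by
  rw [← lintegral_indicator Ω.isOpen.measurableSet]
  refine lintegral_congr fun x => ?_
  by_cases hx : x ∈ Ω
  · rw [Set.indicator_of_mem (by exact hx), enorm_gradient_eq]
  · have h0 : fderiv ℝ φ x = 0 := image_eq_zero_of_notMem_tsupport fun h =>
      hx (φ.tsupport_subset (tsupport_fderiv_subset ℝ h))
    rw [Set.indicator_of_notMem (by exact hx), ← ofReal_norm, h0, norm_zero, ENNReal.ofReal_zero,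
      zero_pow two_ne_zero]

theorem lambdaFrac_le_testFunction {s : ℝ} (h1 : 1 / 2 < s) (h2 : s < 1) {Ω : Opens (Eucl 2)}
    (φ : 𝓓(Ω, ℝ)) (hφ : ∫⁻ x in (Ω : Set (Eucl 2)), ‖φ x‖ₑ ^ 2 ≠ 0) :
    lambdaFrac s Ω ≤ ENNReal.ofReal (16 / (1 - s)) *
      ((∫⁻ x in (Ω : Set (Eucl 2)), ‖gradient φ x‖ₑ ^ 2) /
        ∫⁻ x in (Ω : Set (Eucl 2)), ‖φ x‖ₑ ^ 2) ^ s := by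
  have hs : 0 < s := by linarith
  have hF : ∫⁻ x in (Ω : Set (Eucl 2)), ‖φ x‖ₑ ^ 2 ≠ ∞ := by
    rw [← eLpNorm_two_sq]
    exact ENNReal.pow_ne_top ((memLp_testFunction φ).restrict _).eLpNorm_ne_top
  have hG : ∫⁻ x in (Ω : Set (Eucl 2)), ‖gradient φ x‖ₑ ^ 2 ≠ ∞ := by
    rw [← eLpNorm_two_sq]
    exact ENNReal.pow_ne_top ((memLp_gradient φ).restrict _).eLpNorm_ne_top
  have hgag := gagliardoSq_le_interpolation h1 h2 (φ.contDiff.of_le (by simp))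
    (by rwa [← lintegral_testFunction_eq]) (by rwa [← lintegral_gradient_testFunction_eq])
  rw [← lintegral_testFunction_eq, ← lintegral_gradient_testFunction_eq] at hgag
  set F := ∫⁻ x in (Ω : Set (Eucl 2)), ‖φ x‖ₑ ^ 2 with hFdef
  set G := ∫⁻ x in (Ω : Set (Eucl 2)), ‖gradient φ x‖ₑ ^ 2 with hGdef
  have hfin : gagliardoSq s φ < ∞ := hgag.trans_lt <| ENNReal.mul_lt_top ENNReal.ofReal_lt_top <|
    ENNReal.mul_lt_top (ENNReal.rpow_lt_top_of_nonneg (by linarith) hF)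
      (ENNReal.rpow_lt_top_of_nonneg hs.le hG)
  have hmem : MemWs20 s Ω φ :=
    { memLp := memLp_testFunction φ
      gagliardo_lt_top := ENNReal.rpow_lt_top_of_nonneg (by norm_num) hfin.ne
      approx := fun ε hε => ⟨φ, by simpa [gagliardo, gagliardoSq] using hε⟩ }
  have hne : ¬ (φ : Eucl 2 → ℝ) =ᵐ[volume] 0 := by
    intro h
    rw [hFdef, lintegral_testFunction_eq, ← eLpNorm_two_sq, eLpNorm_congr_ae h] at hφ
    simp at hφ
  calc lambdaFrac s Ω ≤ gagliardoSq s φ / F := by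
        refine iInf_le_of_le φ (iInf₂_le_of_le hmem hne ?_)
        rw [gagliardo_sq]
    _ ≤ ENNReal.ofReal (16 / (1 - s)) * (F ^ (1 - s) * G ^ s) / F := by gcongr
    _ = _ := by
        rw [ENNReal.div_rpow_of_nonneg _ _ hs.le, ENNReal.rpow_sub _ _ hφ hF, ENNReal.rpow_one,
          mul_div_assoc]
        congr 1
        rw [div_eq_mul_inv, div_eq_mul_inv, div_eq_mul_inv]
        calc F * (F ^ s)⁻¹ * G ^ s * F⁻¹ = F * F⁻¹ * (G ^ s * (F ^ s)⁻¹) := by ring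
          _ = _ := by rw [ENNReal.mul_inv_cancel hφ hF, one_mul]

theorem tendsto_of_le_add {a : ℝ≥0∞} (ha : a ≠ ∞) {b ε : ℕ → ℝ≥0∞} (h1 : ∀ n, b n ≤ a + ε n)
    (h2 : ∀ n, a ≤ b n + ε n) (hε : Tendsto ε atTop (𝓝 0)) : Tendsto b atTop (𝓝 a) := by
  have h3 : Tendsto (fun n => a - ε n) atTop (𝓝 (a - 0)) :=
    ENNReal.Tendsto.sub tendsto_const_nhds hε (Or.inl ha)
  have h4 : Tendsto (fun n => a + ε n) atTop (𝓝 (a + 0)) := tendsto_const_nhds.add hε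
  rw [tsub_zero] at h3
  rw [add_zero] at h4
  exact tendsto_of_tendsto_of_tendsto_of_le_of_le h3 h4 (fun n => tsub_le_iff_right.2 (h2 n)) h1

theorem eLpNorm_le_eLpNorm_sub_add {α F : Type*} [MeasurableSpace α] [NormedAddCommGroup F]
    {μ : Measure α} {f g : α → F} (hf : AEStronglyMeasurable f μ) (hg : AEStronglyMeasurable g μ) :
    eLpNorm f 2 μ ≤ eLpNorm g 2 μ + eLpNorm (fun x => f x - g x) 2 μ := by
  have h : f = g + fun x => f x - g x := by ext x; simp
  calc eLpNorm f 2 μ = eLpNorm (g + fun x => f x - g x) 2 μ := by rw [← h]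
    _ ≤ _ := eLpNorm_add_le hg (hf.sub hg) (by norm_num)

/-- The interpolation bound passes from test functions to their closure `W^{1,2}_0`. -/
theorem lambdaFrac_le_of_memW120 {s : ℝ} (h1 : 1 / 2 < s) (h2 : s < 1) {Ω : Opens (Eucl 2)}
    {u : Eucl 2 → ℝ} {g : Eucl 2 → Eucl 2} (hu : MemW120 Ω u g)
    (hne : ¬ u =ᵐ[volume.restrict Ω] 0) :
    lambdaFrac s Ω ≤ ENNReal.ofReal (16 / (1 - s)) *
      ((∫⁻ x in (Ω : Set (Eucl 2)), ‖g x‖ₑ ^ 2) /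
        ∫⁻ x in (Ω : Set (Eucl 2)), ‖u x‖ₑ ^ 2) ^ s := by
  set μ := volume.restrict (Ω : Set (Eucl 2)) with hμ
  have hε0 : ∀ n : ℕ, 0 < (n : ℝ≥0∞)⁻¹ := fun n => ENNReal.inv_pos.2 (ENNReal.natCast_ne_top n)
  choose φ hφ using fun n : ℕ => hu.approx _ (hε0 n)
  have hF : Tendsto (fun n => eLpNorm (φ n) 2 μ) atTop (𝓝 (eLpNorm u 2 μ)) := by
    refine tendsto_of_le_add hu.memLp.eLpNorm_ne_top (ε := fun n : ℕ => (n : ℝ≥0∞)⁻¹)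
      (fun n => ?_) (fun n => ?_) ENNReal.tendsto_inv_nat_nhds_zero
    · refine (eLpNorm_le_eLpNorm_sub_add (φ n).continuous.aestronglyMeasurable
        hu.memLp.aestronglyMeasurable).trans (add_le_add le_rfl ?_)
      rw [show (fun x => φ n x - u x) = -fun x => u x - φ n x by ext x; simp, eLpNorm_neg]
      exact le_self_add.trans (hφ n).le
    · exact (eLpNorm_le_eLpNorm_sub_add hu.memLp.aestronglyMeasurable
        (φ n).continuous.aestronglyMeasurable).trans
        (add_le_add le_rfl (le_self_add.trans (hφ n).le))
  have hG : Tendsto (fun n => eLpNorm (gradient (φ n)) 2 μ) atTop (𝓝 (eLpNorm g 2 μ)) := by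
    refine tendsto_of_le_add hu.memLp_grad.eLpNorm_ne_top (ε := fun n : ℕ => (n : ℝ≥0∞)⁻¹)
      (fun n => ?_) (fun n => ?_) ENNReal.tendsto_inv_nat_nhds_zero
    · refine (eLpNorm_le_eLpNorm_sub_add (continuous_gradient (φ n)).aestronglyMeasurable
        hu.memLp_grad.aestronglyMeasurable).trans (add_le_add le_rfl ?_)
      rw [show (fun x => gradient (φ n) x - g x) = -fun x => g x - gradient (φ n) x by
        ext x; simp, eLpNorm_neg]
      exact le_add_self.trans (hφ n).le
    · exact (eLpNorm_le_eLpNorm_sub_add hu.memLp_grad.aestronglyMeasurable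
        (continuous_gradient (φ n)).aestronglyMeasurable).trans
        (add_le_add le_rfl (le_add_self.trans (hφ n).le))
  have hF0 : eLpNorm u 2 μ ≠ 0 := fun h =>
    hne ((eLpNorm_eq_zero_iff hu.memLp.aestronglyMeasurable two_ne_zero).1 h)
  have hFt : eLpNorm u 2 μ ≠ ∞ := hu.memLp.eLpNorm_ne_top
  have hratio : Tendsto (fun n => ENNReal.ofReal (16 / (1 - s)) *
      (eLpNorm (gradient (φ n)) 2 μ ^ 2 / eLpNorm (φ n) 2 μ ^ 2) ^ s) atTop
      (𝓝 (ENNReal.ofReal (16 / (1 - s)) * (eLpNorm g 2 μ ^ 2 / eLpNorm u 2 μ ^ 2) ^ s)) := by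
    refine ENNReal.Tendsto.const_mul ?_ (Or.inr ENNReal.ofReal_ne_top)
    refine (ENNReal.continuous_rpow_const.tendsto _).comp ?_
    exact ENNReal.Tendsto.div (((ENNReal.continuous_pow 2).tendsto _).comp hG)
      (Or.inr (pow_ne_zero _ hF0)) (((ENNReal.continuous_pow 2).tendsto _).comp hF)
      (Or.inl (ENNReal.pow_ne_top hFt))
  rw [← eLpNorm_two_sq, ← eLpNorm_two_sq]
  refine ge_of_tendsto hratio ?_
  filter_upwards [hF.eventually_ne hF0] with n hn
  have := lambdaFrac_le_testFunction h1 h2 (φ n) (by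
    rw [← eLpNorm_two_sq]; exact pow_ne_zero _ hn)
  rwa [← eLpNorm_two_sq, ← eLpNorm_two_sq] at this

theorem lambdaFrac_le_mul_rpow {s : ℝ} (h1 : 1 / 2 < s) (h2 : s < 1) (Ω : Opens (Eucl 2)) :
    lambdaFrac s Ω ≤ ENNReal.ofReal (16 / (1 - s)) * lambdaOne Ω ^ s := by
  have hs : 0 < s := by linarith
  have hs' : 0 < 1 - s := by linarith
  have hB0 : ENNReal.ofReal (16 / (1 - s)) ≠ 0 := by
    simp only [ne_eq, ENNReal.ofReal_eq_zero, not_le]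
    positivity
  have hB := ENNReal.ofReal_ne_top (r := 16 / (1 - s))
  set B := ENNReal.ofReal (16 / (1 - s)) with hBdef
  have hinf : (B⁻¹ * lambdaFrac s Ω) ^ s⁻¹ ≤ lambdaOne Ω := by
    refine le_iInf fun u => le_iInf fun g => le_iInf₂ fun hu hne => ?_
    rw [ENNReal.rpow_inv_le_iff hs, ENNReal.inv_mul_le_iff hB0 hB]
    exact lambdaFrac_le_of_memW120 h1 h2 hu hne
  rwa [ENNReal.rpow_inv_le_iff hs, ENNReal.inv_mul_le_iff hB0 hB] at hinf

/-- Lower bound: `λ₁ ≤ 4C / r²` in terms of the inradius `r`, while `λ₁ˢ` is at least a multiple of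
`r⁻²ˢ`. -/
theorem mul_rpow_le_lambdaFrac {C : ℝ} (hC : 0 < C)
    (hCle : ∀ (Ω : Opens (Eucl 2)) (x₀ : Eucl 2) (ρ : ℝ), 0 < ρ →
      Metric.ball x₀ ρ ⊆ (Ω : Set (Eucl 2)) → lambdaOne Ω ≤ ENNReal.ofReal (C / ρ ^ 2))
    {s : ℝ} (h1 : 1 / 2 < s) (h2 : s < 1) {Ω : Opens (Eucl 2)}
    (hΩ : IsSimplyConnected (Ω : Set (Eucl 2))) (hin : inradius Ω < ∞) :
    ENNReal.ofReal (1 / (43545600 * (4 * C + 1)) * ((2 * s - 1) / (1 - s))) * lambdaOne Ω ^ s ≤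
      lambdaFrac s Ω := by
  have hs : 0 < s := by linarith
  have hs1 : 0 < 1 - s := by linarith
  have hs2 : 0 < 2 * s - 1 := by linarith
  set r := (inradius Ω).toReal with hrdef
  have hr : 0 < r := ENNReal.toReal_pos (inradius_pos hΩ.nonempty).ne' hin.ne
  have hrin : inradius Ω = ENNReal.ofReal r := (ENNReal.ofReal_toReal hin.ne).symm
  obtain ⟨x, hx⟩ := exists_ball_subset_of_lt_inradius (Ω := Ω) (ρ := r / 2) (by
    rw [hrin, ENNReal.ofReal_lt_ofReal_iff hr]; linarith)
  have hup : lambdaOne Ω ^ s ≤ ENNReal.ofReal ((4 * C + 1) / r ^ (2 * s)) := by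
    calc lambdaOne Ω ^ s ≤ ENNReal.ofReal (C / (r / 2) ^ 2) ^ s :=
          ENNReal.rpow_le_rpow (hCle Ω x (r / 2) (by positivity) hx) hs.le
      _ = ENNReal.ofReal ((4 * C) ^ s / r ^ (2 * s)) := by
          rw [ENNReal.ofReal_rpow_of_pos (by positivity),
            show C / (r / 2) ^ 2 = 4 * C / r ^ 2 by field_simp; norm_num,
            Real.div_rpow (by positivity) (by positivity), ← Real.rpow_natCast r,
            ← Real.rpow_mul hr.le]
          norm_num
      _ ≤ _ := by
          refine ENNReal.ofReal_le_ofReal ?_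
          gcongr
          calc (4 * C) ^ s ≤ (4 * C + 1) ^ s := by gcongr; linarith
            _ ≤ (4 * C + 1) ^ (1 : ℝ) :=
              Real.rpow_le_rpow_of_exponent_le (by linarith) h2.le
            _ = _ := Real.rpow_one _
  have hlow := inv_le_lambdaFrac_of_isSimplyConnected h1 h2 hΩ (R := 2 * r) (by positivity) (by
    rw [hrin, ENNReal.ofReal_lt_ofReal_iff (by positivity)]; linarith)
  refine (mul_le_mul_right hup _).trans (le_trans ?_ hlow)
  have h2mul : ∀ y : ℝ, 2 * ENNReal.ofReal y = ENNReal.ofReal (2 * y) := fun y => by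
    rw [ENNReal.ofReal_mul zero_le_two, ENNReal.ofReal_ofNat]
  rw [h2mul, ← ENNReal.ofReal_inv_of_pos (by positivity), ← ENNReal.ofReal_mul (by positivity)]
  refine ENNReal.ofReal_le_ofReal ?_
  rw [Real.mul_rpow (by norm_num) hr.le]
  have h4 : (2 : ℝ) ^ (2 * s) ≤ 4 := by
    calc (2 : ℝ) ^ (2 * s) ≤ 2 ^ (2 : ℝ) :=
          Real.rpow_le_rpow_of_exponent_le (by norm_num) (by linarith)
      _ = 4 := by norm_num
  have hrs : 0 < r ^ (2 * s) := by positivity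
  calc 1 / (43545600 * (4 * C + 1)) * ((2 * s - 1) / (1 - s)) * ((4 * C + 1) / r ^ (2 * s))
      = (2 * (5443200 * ((1 - s) / (2 * s - 1)) * (4 * r ^ (2 * s))))⁻¹ := by
        field_simp
        norm_num
    _ ≤ _ := by gcongr

end FracEig

theorem corollary6p4 :
    ∃ α β : ℝ → ℝ,
      (∀ s : ℝ, 1 / 2 < s → s < 1 → 0 < α s ∧ 0 < β s) ∧
      (∀ s : ℝ, 1 / 2 < s → s < 1 →
        ∀ Ω : TopologicalSpace.Opens (FracEig.Eucl 2),
          IsSimplyConnected (Ω : Set (FracEig.Eucl 2)) → FracEig.inradius Ω < ∞ →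
            ENNReal.ofReal (α s) * FracEig.lambdaOne Ω ^ s ≤ FracEig.lambdaFrac s Ω ∧
            FracEig.lambdaFrac s Ω ≤ ENNReal.ofReal (β s) * FracEig.lambdaOne Ω ^ s) ∧
      (∃ c : ℝ, 0 < c ∧ Tendsto (fun s => α s / (s - 1 / 2)) (𝓝[>] (1 / 2)) (𝓝 c)) ∧
      (∃ c : ℝ, 0 < c ∧ Tendsto (fun s => α s / (1 / (1 - s))) (𝓝[<] 1) (𝓝 c)) ∧
      (∃ c : ℝ, 0 < c ∧ Tendsto (fun s => β s / (1 / (1 - s))) (𝓝[<] 1) (𝓝 c)) := by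
  obtain ⟨C, hC, hCle⟩ := FracEig.exists_lambdaOne_le
  set c : ℝ := 1 / (43545600 * (4 * C + 1)) with hc
  have hc0 : 0 < c := by positivity
  refine ⟨fun s => c * ((2 * s - 1) / (1 - s)), fun s => 16 / (1 - s), fun s h1 h2 => ?_,
    fun s h1 h2 Ω hΩ hin => ⟨FracEig.mul_rpow_le_lambdaFrac hC hCle h1 h2 hΩ hin,
      FracEig.lambdaFrac_le_mul_rpow h1 h2 Ω⟩, ⟨4 * c, by positivity, ?_⟩, ⟨c, hc0, ?_⟩,
    ⟨16, by norm_num, ?_⟩⟩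
  · have : 0 < 2 * s - 1 := by linarith
    have : 0 < 1 - s := by linarith
    exact ⟨by positivity, by positivity⟩
  · have hcont : ContinuousAt (fun s : ℝ => 2 * c / (1 - s)) (1 / 2) :=
      ContinuousAt.div (by fun_prop) (by fun_prop) (by norm_num)
    have hlim : Tendsto (fun s : ℝ => 2 * c / (1 - s)) (𝓝[>] (1 / 2)) (𝓝 (4 * c)) := by
      refine (hcont.tendsto.mono_left nhdsWithin_le_nhds).trans (le_of_eq ?_)
      congr 1
      norm_num
      ring
    refine hlim.congr' ?_
    filter_upwards [self_mem_nhdsWithin] with s hs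
    have h1 : s - 1 / 2 ≠ 0 := sub_ne_zero.2 (ne_of_gt hs)
    rw [show 2 * s - 1 = 2 * (s - 1 / 2) by ring]
    generalize s - 1 / 2 = t at h1 ⊢
    field_simp
  · have hlim : Tendsto (fun s : ℝ => c * (2 * s - 1)) (𝓝[<] 1) (𝓝 (c * (2 * 1 - 1))) :=
      (Continuous.tendsto (by fun_prop) 1).mono_left nhdsWithin_le_nhds
    norm_num at hlim
    refine hlim.congr' ?_
    filter_upwards [self_mem_nhdsWithin] with s hs
    have h1 : 1 - s ≠ 0 := sub_ne_zero.2 (ne_of_gt hs)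
    field_simp
  · refine tendsto_const_nhds.congr' ?_
    filter_upwards [self_mem_nhdsWithin] with s hs
    have h1 : 1 - s ≠ 0 := sub_ne_zero.2 (ne_of_gt hs)
    field_simp
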